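/- Let $M$ be a smooth, finite-dimensional, Hausdorff, paracompact and simply connected (in particular connected) manifold without boundary, let $H$ be a finite-dimensional real Lie group with Lie algebra $\mathfrak h$, and let $\pi:P\to M$ be a smooth principal $H$-bundle with right action $R_h(p)=ph$. A connection form on $P$ is a smooth $\mathfrak h$-valued $1$-form $\omega$ on $P$ with $\omega(X^\#)=X$ for all $X\in\mathfrak h$ ($X^\#$ being the fundamental vector field of $X$) and $R_h^*\omega=\mathrm{Ad}_{h^{-1}}\omega$; it is flat if $\Omega=d\omega+\tfrac12[\omega,\omega]=0$. A dressing field is a smooth map $\bar u:P\to H$ with $R_h^*\bar u=h^{-1}\bar u$. The gauge group $\mathcal H$ consists of the smooth maps $\bar\gamma:P\to H$ with $R_h^*\bar\gamma=h^{-1}\bar\gamma h$; it acts on maps and forms on $P$ by pull-back, $\bar u^{\bar\gamma}:=\Phi^*\bar u$ and $\omega^{\bar\gamma}:=\Phi^*\omega$, where $\Phi(p)=p\,\bar\gamma(p)$. For a smooth map $f$ with values in $H$, $f^{-1}df:=f^*\omega_H$ is the pull-back of the left-invariant Maurer–Cartan form $\omega_H$ of $H$, and $f\,df^{-1}$ is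 this form for the pointwise inverse $f^{-1}$ in place of $f$. Then: 1. $P$ admits a flat connection form if and only if $P$ admits a dressing field. 2. Every flat connection form on $P$ is of the form $\mathring\omega=\bar u\,d\bar u^{-1}$ for some dressing field $\bar u$. 3. Let $\bar u$ be a dressing field. Then: (a) $\phi(p)=(\pi(p),\bar u(p)^{-1})$ is an isomorphism of principal $H$-bundles $P\to M\times H$ over $M$ (so $P$ is trivial), and $\bar u\,d\bar u^{-1}=\phi^*\pi_H^*\omega_H$, where $\pi_H:M\times H\to H$ is the projection. (b) $\mathring\omega:=\bar u\,d\bar u^{-1}$ is a flat connection form on $P$. (c) For every smooth global section $\sigma:M\to P$, setting $u=\sigma^*\bar u$, the form $A_{\rm pure}:=\sigma^*\mathring\omega$ equals $u\,du^{-1}$ and satisfies $F_{\rm pure}=dA_{\rm pure}+\tfrac12[A_{\rm pure},A_{\rm pure}]=0$. (d) For every $\bar\gamma\in\mathcal H$: $\bar u^{\bar\gamma}=\bar\gamma^{-1}\bar u$, this is again a dressing field, and $\mathring\omega^{\bar\gamma}=\bar u^{\bar\gamma}\,d(\bar u^{\bar\gamma})^{-1}=\mathrm{Ad}_{\bar\gamma^{-1}}\mathring\omega+\bar\gamma^{-1}d\bar\gamma$.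 Moreover, for every connection form $\omega$ on $P$, the form $\alpha=\omega-\mathring\omega$ satisfies $\alpha^{\bar\gamma}=\mathrm{Ad}_{\bar\gamma^{-1}}\alpha$. -/

import Mathlib

open scoped Manifold ContDiff

noncomputable section

namespace GaugeTheory

section Forms

variable {EN : Type*} [NormedAddCommGroup EN] [NormedSpace ℝ EN]
  {KN : Type*} [TopologicalSpace KN] (IN : ModelWithCorners ℝ EN KN)
  (N : Type*) [TopologicalSpace N] [ChartedSpace KN N]
  {EN' : Type*} [NormedAddCommGroup EN'] [NormedSpace ℝ EN']
  {KN' : Type*} [TopologicalSpace KN'] (IN' : ModelWithCorners ℝ EN' KN')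
  {N' : Type*} [TopologicalSpace N'] [ChartedSpace KN' N']
  {EH : Type*} [NormedAddCommGroup EH] [NormedSpace ℝ EH]
  {KH : Type*} [TopologicalSpace KH] (IH : ModelWithCorners ℝ EH KH)
  (H : Type*) [TopologicalSpace H] [ChartedSpace KH H] [Group H]

/-- (Not necessarily smooth) differential `1`-forms on `N` with values in the Lie algebra
`T₁H` of the Lie group `H`. -/
abbrev LieForm : Type _ := ∀ x : N, TangentSpace IN x →L[ℝ] GroupLieAlgebra IH H

variable {N H}

/-- A Lie algebra valued `1`-form is smooth if it is smooth as a (fibrewise linear) map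
`TN → T₁H` on the tangent bundle. -/
def LieForm.IsSmooth [IsManifold IN 1 N] (A : LieForm IN N IH H) : Prop :=
  let F : TangentBundle IN N → EH := fun v ↦ A v.1 v.2
  ContMDiff IN.tangent 𝓘(ℝ, EH) ∞ F

/-- The pull-back `f^*ω` of a Lie algebra valued `1`-form along a map `f`. -/
def LieForm.pullback (f : N → N') (A : LieForm IN' N' IH H) : LieForm IN N IH H :=
  fun x ↦ (A (f x)).comp (mfderiv IN IN' f x)

/-- The exterior derivative of a Lie algebra valued `1`-form, evaluated on two vector fields:
`dω(X, Y) = X(ω(Y)) - Y(ω(X)) - ω([X, Y])`. -/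
def LieForm.extDeriv (A : LieForm IN N IH H) (X Y : ∀ x : N, TangentSpace IN x) (x : N) :
    GroupLieAlgebra IH H :=
  let AX : N → EH := fun y ↦ A y (X y)
  let AY : N → EH := fun y ↦ A y (Y y)
  let XAY : GroupLieAlgebra IH H := mfderiv IN 𝓘(ℝ, EH) AY x (X x)
  let YAX : GroupLieAlgebra IH H := mfderiv IN 𝓘(ℝ, EH) AX x (Y x)
  XAY - YAX - A x (VectorField.mlieBracket IN X Y x)

/-- The curvature `Ω = dω + ½[ω, ω]` evaluated on two vector fields:
`Ω(X, Y) = dω(X, Y) + [ω(X), ω(Y)]`. -/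
def LieForm.curvature (A : LieForm IN N IH H) (X Y : ∀ x : N, TangentSpace IN x) (x : N) :
    GroupLieAlgebra IH H :=
  A.extDeriv IN IH X Y x + ⁅A x (X x), A x (Y x)⁆

/-- Vanishing curvature. The curvature at `x` only depends on the vector fields near `x`, so
the fields are only asked to be smooth at the point under consideration. -/
def LieForm.IsFlat [IsManifold IN 1 N] (A : LieForm IN N IH H) : Prop :=
  ∀ (x : N) (X Y : ∀ y : N, TangentSpace IN y),
    ContMDiffAt IN IN.tangent ∞ (fun y ↦ (⟨y, X y⟩ : TangentBundle IN N)) x →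
    ContMDiffAt IN IN.tangent ∞ (fun y ↦ (⟨y, Y y⟩ : TangentBundle IN N)) x →
    A.curvature IN IH X Y x = 0

/-- The (left-invariant) Maurer-Cartan form `ω_H` of `H`: `v ∈ T_g H ↦ (L_{g⁻¹})_* v ∈ T₁H`. -/
def maurerCartan : LieForm IH H IH H := fun g ↦
  let D : TangentSpace IH g →L[ℝ] TangentSpace IH (g⁻¹ * g) := mfderiv IH IH (fun a ↦ g⁻¹ * a) g
  D

/-- The adjoint action of `h` on the Lie algebra: the derivative at `1` of `g ↦ h g h⁻¹`. -/
def Ad (h : H) : GroupLieAlgebra IH H →L[ℝ] GroupLieAlgebra IH H :=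
  let D : TangentSpace IH (1 : H) →L[ℝ] TangentSpace IH (h * 1 * h⁻¹) :=
    mfderiv IH IH (fun g ↦ h * g * h⁻¹) 1
  D

/-- The Lie algebra valued `1`-form `f⁻¹ df` of a map `f : N → H`. -/
def invMulD (f : N → H) : LieForm IN N IH H :=
  fun x ↦ (maurerCartan IH (f x)).comp (mfderiv IN IH f x)

/-- The Lie algebra valued `1`-form `u du⁻¹` of a map `u : N → H`, that is `f⁻¹ df` for
`f = u⁻¹`. -/
def pureGauge (u : N → H) : LieForm IN N IH H := invMulD IN IH (fun x ↦ (u x)⁻¹)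

end Forms

section Bundle

variable {EM : Type*} [NormedAddCommGroup EM] [NormedSpace ℝ EM]
  {KM : Type*} [TopologicalSpace KM] (IM : ModelWithCorners ℝ EM KM)
  {M : Type*} [TopologicalSpace M] [ChartedSpace KM M]
  {EH : Type*} [NormedAddCommGroup EH] [NormedSpace ℝ EH]
  {KH : Type*} [TopologicalSpace KH] (IH : ModelWithCorners ℝ EH KH)
  {H : Type*} [TopologicalSpace H] [ChartedSpace KH H] [Group H]
  {EP : Type*} [NormedAddCommGroup EP] [NormedSpace ℝ EP]
  {KP : Type*} [TopologicalSpace KP] (IP : ModelWithCorners ℝ EP KP)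
  {P : Type*} [TopologicalSpace P] [ChartedSpace KP P] [MulAction Hᵐᵒᵖ P]

variable (H) in
/-- `π : P → M`, together with the right action `p h = op h • p` of `H` on `P`, is a smooth
principal `H`-bundle: the action is smooth and preserves the fibres, and there are local
trivialisations `π⁻¹(U) → U × H` which are smooth with smooth inverse and equivariant. -/
structure IsPrincipalBundle (π : P → M) : Prop where
  contMDiff_proj : ContMDiff IP IM ∞ π
  contMDiff_act : ContMDiff (IP.prod IH) IP ∞ (fun z : P × H ↦ MulOpposite.op z.2 • z.1)
  proj_act : ∀ (p : P) (h : H), π (MulOpposite.op h • p) = π p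
  exists_trivialization : ∀ x : M, ∃ e : Bundle.Trivialization H π, x ∈ e.baseSet ∧
    ContMDiffOn IP (IM.prod IH) ∞ e e.source ∧
    ContMDiffOn (IM.prod IH) IP ∞ e.toOpenPartialHomeomorph.symm e.target ∧
    ∀ p ∈ e.source, ∀ h : H, (e (MulOpposite.op h • p)).2 = (e p).2 * h

/-- `φ : P → M × H` is an isomorphism of principal `H`-bundles over `M` from `π : P → M` to the
trivial bundle `M × H` (with right action `(x, g) h = (x, g h)`). -/
def IsTrivialisation (π : P → M) (φ : P ≃ₘ^∞⟮IP, IM.prod IH⟯ (M × H)) : Prop :=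
  (∀ p : P, (φ p).1 = π p) ∧
    ∀ (p : P) (h : H), φ (MulOpposite.op h • p) = ((φ p).1, (φ p).2 * h)

/-- The fundamental (vertical) vector at `p` generated by an element of the Lie algebra: the
derivative of `h ↦ p h` at `1`. -/
def fundamentalVector (p : P) : GroupLieAlgebra IH H →L[ℝ] TangentSpace IP p :=
  let D : TangentSpace IH (1 : H) →L[ℝ] TangentSpace IP (MulOpposite.op (1 : H) • p) :=
    mfderiv IH IP (fun h : H ↦ MulOpposite.op h • p) 1
  D

/-- Connection `1`-forms on `P`: smooth Lie algebra valued `1`-forms which restrict to the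
canonical isomorphism (inverse to `X ↦ X^#`) on vertical vectors, and with
`R_h^* ω = Ad_{h⁻¹} ω`. -/
structure IsConnectionForm [IsManifold IP 1 P] (A : LieForm IP P IH H) : Prop where
  smooth : A.IsSmooth IP IH
  vertical : ∀ (p : P) (X : GroupLieAlgebra IH H), A p (fundamentalVector IH IP p X) = X
  equivariant : ∀ h : H,
    LieForm.pullback IP IP IH (fun p : P ↦ MulOpposite.op h • p) A =
      fun p ↦ (Ad IH h⁻¹).comp (A p)

/-- Dressing fields: smooth maps `u : P → H` with `R_h^* u = h⁻¹ u`. -/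
structure IsDressingField (u : P → H) : Prop where
  smooth : ContMDiff IP IH ∞ u
  equivariant : ∀ (p : P) (h : H), u (MulOpposite.op h • p) = h⁻¹ * u p

/-- Elements of the gauge group: smooth maps `γ : P → H` with `R_h^* γ = h⁻¹ γ h`. -/
structure IsGaugeElement (γ : P → H) : Prop where
  smooth : ContMDiff IP IH ∞ γ
  equivariant : ∀ (p : P) (h : H), γ (MulOpposite.op h • p) = h⁻¹ * γ p * h

/-- The vertical automorphism `Φ(p) = p γ(p)` of `P` given by a gauge group element `γ`. The gauge
group acts on maps and forms on `P` by pull-back along these automorphisms. -/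
def gaugeMap (γ : P → H) : P → P := fun p ↦ MulOpposite.op (γ p) • p

end Bundle

end GaugeTheory

end

open GaugeTheory

/-!
The heart of the matter is that a flat connection form `A` on a principal bundle over a simply
connected manifold has a global horizontal section `σ`, that is one with `σ^*A = 0`. Writing
`p = σ(π p) g(p)` defines a smooth map `g : P → H` with `g(p h) = g(p) h`, and the product rule
`A(d(f·g)) = Ad_{g⁻¹} A(df) + g⁻¹ dg` (`IsConnectionForm.toFun_mfd_smul`), applied to `f = σ ∘ π`,
gives `A = g⁻¹ dg`. Hence `u = g⁻¹` is a dressing field with `A = u du⁻¹`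
(`IsFlatSection.exists_dressingField`).

Horizontal sections exist locally by the Frobenius theorem. In a local parametrisation of `P`, by
the base times the group, a horizontal section is a solution of a total differential equation
`Df(x) = F(x, f x)`, and flatness of `A` is its integrability condition
(`TotalODE.exists_graph_subset_ker`, `exists_isFlatSection`). The equation is solved along rays
(`TotalODE.exists_hasFDerivAt`): the radial solutions exist by Picard–Lindelöf, and a Grönwall
estimate, in which the first order terms cancel thanks to integrability, shows that their end points
depend differentiably on the direction, with the required derivative.

Two horizontal sections differ by a map to `H` with vanishing differential, so they agree near any
point where they agree (`IsFlatSection.eventually_eq`), and right translates of horizontal sections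
are horizontal. Therefore `P`, with the topology generated by the images of the horizontal sections,
is a covering space of `M`; as `M` is simply connected, its identity map lifts to a global
horizontal section (`exists_section_of_locally`, `IsConnectionForm.exists_isFlatSection_univ`).

Conversely, for a dressing field `u` the form `u du⁻¹` is a connection form by equivariance
(`IsDressingField.isConnectionForm`), and it is flat by the Maurer–Cartan equation
(`isFlat_invMulD`): the latter holds since it can be tested on left-invariant fields, and flatness
is preserved under pull-back. Both arguments use that the curvature, which is defined by vector
fields, is given by the usual formula in a local parametrisation (`curvature_eq`). The map
`p ↦ p u(p)` is constant on the fibres and yields the global section which inverts the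
trivialisation (`IsDressingField.exists_section`). The transformation laws under the gauge group are
instances of the product rule with `f(p) = p` and `g = γ`.
-/

section

open Set Filter Topology Metric
open scoped NNReal

noncomputable section

/-! ### Total differential equations -/

namespace TotalODE

variable {E G : Type*} [NormedAddCommGroup E] [NormedSpace ℝ E]
  [NormedAddCommGroup G] [NormedSpace ℝ G]

/-- With zero initial value, the Grönwall bound is linear in the size of the error. -/
theorem gronwallBound_zero_mul (K c ε x : ℝ) :
    gronwallBound 0 K (c * ε) x = gronwallBound 0 K c x * ε := by
  unfold gronwallBound
  split_ifs <;> ring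

/-- Uniform bounds, on a ball, for the right-hand side of a total differential equation. -/
structure Bounds (F : E × G → E →L[ℝ] G) (z₀ : E × G) (a : ℝ) (K L C : ℝ≥0) : Prop where
  differentiableAt : ∀ z ∈ closedBall z₀ a, DifferentiableAt ℝ F z
  norm_le : ∀ z ∈ closedBall z₀ a, ‖F z‖ ≤ K
  norm_fderiv_le : ∀ z ∈ closedBall z₀ a, ‖fderiv ℝ F z‖ ≤ L
  lipschitz_fderiv : LipschitzOnWith C (fderiv ℝ F) (closedBall z₀ a)

/-- A `C²` right-hand side satisfies such bounds near every point. -/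
theorem exists_bounds {F : E × G → E →L[ℝ] G} {z₀ : E × G} (hF : ContDiffAt ℝ 2 F z₀)
    {Ω : Set (E × G)} (hΩ : Ω ∈ 𝓝 z₀) :
    ∃ a > 0, ∃ K L C : ℝ≥0, Bounds F z₀ a K L C ∧ closedBall z₀ a ⊆ Ω := by
  have h1 : ContDiffAt ℝ 1 (fderiv ℝ F) z₀ := hF.fderiv_right (by norm_num)
  obtain ⟨C, s, hs, hC⟩ := h1.exists_lipschitzOnWith
  have e1 : ∀ᶠ z in 𝓝 z₀, DifferentiableAt ℝ F z :=
    (hF.eventually (by simp)).mono fun z hz ↦ hz.differentiableAt (by norm_num)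
  have e2 : ∀ᶠ z in 𝓝 z₀, ‖F z‖ < ‖F z₀‖ + 1 :=
    hF.continuousAt.norm.eventually (gt_mem_nhds (lt_add_one _))
  obtain ⟨a, ha, hsub⟩ := nhds_basis_closedBall.mem_iff.1 (inter_mem (inter_mem hs hΩ)
    (inter_mem e1 e2))
  refine ⟨a, ha, ⟨‖F z₀‖ + 1, by positivity⟩, ⟨‖fderiv ℝ F z₀‖ + C * a, by positivity⟩, C,
    ⟨fun z hz ↦ (hsub hz).2.1, fun z hz ↦ (hsub hz).2.2.le, fun z hz ↦ ?_,
      hC.mono fun z hz ↦ (hsub hz).1.1⟩, fun z hz ↦ (hsub hz).1.2⟩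
  have h2 := hC.norm_sub_le (hsub hz).1.1 (mem_of_mem_nhds hs)
  calc ‖fderiv ℝ F z‖ ≤ ‖fderiv ℝ F z₀‖ + ‖fderiv ℝ F z - fderiv ℝ F z₀‖ :=
      norm_le_norm_add_norm_sub' (fderiv ℝ F z) (fderiv ℝ F z₀)
    _ ≤ ‖fderiv ℝ F z₀‖ + C * a := by
      gcongr
      exact h2.trans (by gcongr; exact mem_closedBall_iff_norm.1 hz)

namespace Bounds

variable {F : E × G → E →L[ℝ] G} {x₀ : E} {y₀ : G} {a : ℝ} {K L C : ℝ≥0}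

theorem lipschitz {z₀ : E × G} (hB : Bounds F z₀ a K L C) :
    LipschitzOnWith L F (closedBall z₀ a) :=
  (convex_closedBall z₀ a).lipschitzOnWith_of_nnnorm_fderiv_le hB.differentiableAt
    fun z hz ↦ hB.norm_fderiv_le z hz

/-- The first order Taylor estimate, from the Lipschitz bound on the derivative. -/
theorem taylor {z₀ : E × G} (hB : Bounds F z₀ a K L C) {z z' : E × G}
    (hz : z ∈ closedBall z₀ a) (hz' : z' ∈ closedBall z₀ a) :
    ‖F z' - F z - fderiv ℝ F z (z' - z)‖ ≤ C * ‖z' - z‖ ^ 2 := by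
  have := Convex.norm_image_sub_le_of_norm_fderiv_le' (𝕜 := ℝ) (f := F) (φ := fderiv ℝ F z)
    (C := C * ‖z' - z‖) (s := closedBall z₀ a ∩ closedBall z ‖z' - z‖) (x := z) (y := z')
    (fun w hw ↦ hB.differentiableAt w hw.1)
    (fun w hw ↦ (hB.lipschitz_fderiv.norm_sub_le hw.1 hz).trans (by
      gcongr; exact mem_closedBall_iff_norm.1 hw.2))
    ((convex_closedBall _ _).inter (convex_closedBall _ _))
    ⟨hz, mem_closedBall_self (norm_nonneg _)⟩ ⟨hz', mem_closedBall_iff_norm.2 le_rfl⟩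
  rwa [mul_assoc, ← sq] at this

theorem mem_closedBall_add_smul {G : Type*} [NormedAddCommGroup G] {y₀ y : G} {h : E}
    (hh : ‖h‖ ≤ a) (hy : ‖y - y₀‖ ≤ a) {t : ℝ} (ht : t ∈ Icc (0 : ℝ) 1) :
    (x₀ + t • h, y) ∈ closedBall (x₀, y₀) a := by
  rw [← closedBall_prod_same]
  refine ⟨?_, mem_closedBall_iff_norm.2 hy⟩
  rw [mem_closedBall_iff_norm, add_sub_cancel_left, norm_smul, Real.norm_of_nonneg ht.1]
  nlinarith [ht.1, ht.2, norm_nonneg h]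

/-- The ordinary differential equation satisfied by a solution of `Df(x) = F(x, f x)` along the
ray from `x₀` in the direction `h` has a solution up to time one, provided `h` is small. -/
theorem exists_radial_solution [CompleteSpace G] (hB : Bounds F (x₀, y₀) a K L C) (ha : 0 < a)
    {h : E} (hh : ‖h‖ ≤ a) (hKh : K * ‖h‖ ≤ a / 2) :
    ∃ α : ℝ → G, α 0 = y₀ ∧
      (∀ t ∈ Icc (0 : ℝ) 1, HasDerivWithinAt α (F (x₀ + t • h, α t) h) (Icc 0 1) t) ∧
      ∀ t ∈ Icc (0 : ℝ) 1, ‖α t - y₀‖ ≤ a / 2 := by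
  let a' : ℝ≥0 := ⟨a / 2, by positivity⟩
  have ha' : (a' : ℝ) = a / 2 := rfl
  have hP : IsPicardLindelof (fun t y ↦ F (x₀ + t • h, y) h) (tmin := 0) (tmax := 1)
      ⟨0, by simp⟩ y₀ a' 0 (K * ‖h‖₊) (L * ‖h‖₊) := by
    have hm : ∀ t ∈ Icc (0 : ℝ) 1, ∀ y ∈ closedBall y₀ (a' : ℝ),
        (x₀ + t • h, y) ∈ closedBall (x₀, y₀) a := fun t ht y hy ↦
      mem_closedBall_add_smul hh ((mem_closedBall_iff_norm.1 hy).trans (by rw [ha']; linarith)) ht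
    refine ⟨fun t ht ↦ ?_, fun y hy ↦ ?_, fun t ht y hy ↦ ?_, ?_⟩
    · refine LipschitzOnWith.of_dist_le_mul fun y hy y' hy' ↦ ?_
      have h1 := hB.lipschitz.norm_sub_le (hm t ht y hy) (hm t ht y' hy')
      have h2 : ‖((x₀ + t • h, y) : E × G) - (x₀ + t • h, y')‖ = ‖y - y'‖ := by simp
      rw [h2] at h1
      rw [dist_eq_norm, dist_eq_norm, ← sub_apply]
      refine (ContinuousLinearMap.le_opNorm _ _).trans ?_
      push_cast
      calc _ ≤ L * ‖y - y'‖ * ‖h‖ := by gcongr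
        _ = _ := by ring
    · have hc : ContinuousOn F (closedBall (x₀, y₀) a) := hB.lipschitz.continuousOn
      exact (hc.comp (by fun_prop) fun t ht ↦ hm t ht y hy).clm_apply continuousOn_const
    · refine (ContinuousLinearMap.le_opNorm _ _).trans ?_
      push_cast
      have := hB.norm_le _ (hm t ht y hy)
      gcongr
    · push_cast
      simpa [ha'] using hKh
  obtain ⟨α, hα⟩ := ODE.FunSpace.exists_isFixedPt_next hP
    (mem_closedBall_self (ε := ((0 : ℝ≥0) : ℝ)) le_rfl)
  have hmem : ∀ t, α.compProj t ∈ closedBall y₀ (a' : ℝ) := fun t ↦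
    α.compProj_mem_closedBall hP.mul_max_le
  refine ⟨α.compProj, ?_, fun t ht ↦ ?_, fun t _ ↦ mem_closedBall_iff_norm.1 (hmem t)⟩
  · have := ODE.FunSpace.compProj_val (α := α) (t := (⟨0, by simp⟩ : Icc (0 : ℝ) 1))
    exact this.trans (by rw [← hα, ODE.FunSpace.next_apply₀])
  · refine (ODE.hasDerivWithinAt_picard_Icc (⟨0, by simp⟩ : Icc (0 : ℝ) 1).2 hP.continuousOn_uncurry
      α.continuous_compProj.continuousOn (fun _ _ ↦ hmem _) y₀ ht).congr_of_mem ?_ ht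
    intro t ht
    rw [ODE.FunSpace.compProj_of_mem ht]
    conv_lhs => rw [← hα, ODE.FunSpace.next_apply]

/-- First-order dependence of the radial solutions on their direction. If `α` and `β` are the
solutions in the directions `h` and `h + k`, then `t ↦ α t + t • F (x₀ + t • h, α t) k` solves the
equation of `β` up to an error `O(‖k‖ ^ 2)`: the terms which are linear in `k` cancel because of the
integrability condition. Grönwall's inequality does the rest. -/
theorem norm_radial_sub_le (hB : Bounds F (x₀, y₀) a K L C)
    (hint : ∀ z ∈ closedBall (x₀, y₀) a, ∀ v w,
      fderiv ℝ F z (v, F z v) w = fderiv ℝ F z (w, F z w) v)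
    {h k : E} (hh : ‖h‖ ≤ a) (hhk : ‖h + k‖ ≤ a) (hKk : K * ‖k‖ ≤ a / 2) {α β : ℝ → G}
    (hα0 : α 0 = y₀) (hβ0 : β 0 = y₀)
    (hα : ∀ t ∈ Icc (0 : ℝ) 1, HasDerivWithinAt α (F (x₀ + t • h, α t) h) (Icc 0 1) t)
    (hαm : ∀ t ∈ Icc (0 : ℝ) 1, ‖α t - y₀‖ ≤ a / 2)
    (hβ : ∀ t ∈ Icc (0 : ℝ) 1,
      HasDerivWithinAt β (F (x₀ + t • (h + k), β t) (h + k)) (Icc 0 1) t)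
    (hβm : ∀ t ∈ Icc (0 : ℝ) 1, ‖β t - y₀‖ ≤ a / 2) :
    ‖β 1 - α 1 - F (x₀ + h, α 1) k‖ ≤
      gronwallBound 0 (L * a) (L * (1 + K) + C * (1 + K) ^ 2 * a) 1 * ‖k‖ ^ 2 := by
  have ha : 0 ≤ a := (norm_nonneg _).trans hh
  let z : ℝ → E × G := fun t ↦ (x₀ + t • h, α t)
  have hz : ∀ t ∈ Icc (0 : ℝ) 1, z t ∈ closedBall (x₀, y₀) a := fun t ht ↦
    mem_closedBall_add_smul hh ((hαm t ht).trans (by linarith)) ht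
  -- the first order approximation of `β`
  let ψ : ℝ → G := fun t ↦ α t + t • F (z t) k
  have hψm : ∀ t ∈ Icc (0 : ℝ) 1, ‖ψ t - y₀‖ ≤ a := fun t ht ↦ by
    have h1 : ‖t • F (z t) k‖ ≤ a / 2 := by
      rw [norm_smul, Real.norm_of_nonneg ht.1]
      have h2 := (F (z t)).le_of_opNorm_le (hB.norm_le _ (hz t ht)) k
      nlinarith [ht.1, ht.2, norm_nonneg (F (z t) k)]
    calc ‖ψ t - y₀‖ = ‖(α t - y₀) + t • F (z t) k‖ := by simp only [ψ]; congr 1; abel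
      _ ≤ _ := (norm_add_le _ _).trans (by linarith [hαm t ht])
  have hz' : ∀ t ∈ Icc (0 : ℝ) 1, HasDerivWithinAt z (h, F (z t) h) (Icc 0 1) t := fun t ht ↦ by
    refine HasDerivWithinAt.prodMk ?_ (hα t ht)
    simpa using (((hasDerivWithinAt_id t (Icc (0 : ℝ) 1)).smul_const h).const_add x₀)
  have hψ' : ∀ t ∈ Icc (0 : ℝ) 1, HasDerivWithinAt ψ
      (F (z t) h + (t • (fderiv ℝ F (z t) (h, F (z t) h)) k + (1 : ℝ) • F (z t) k))
      (Icc 0 1) t := fun t ht ↦ by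
    refine (hα t ht).add ?_
    have h1 := ((hB.differentiableAt _ (hz t ht)).hasFDerivAt.comp_hasDerivWithinAt t (hz' t ht))
    exact (hasDerivWithinAt_id t _).smul (h1.clm_apply (hasDerivWithinAt_const t _ k) |>.congr_deriv
      (by simp))
  have hIci : ∀ {γ : ℝ → G} {γ' : G} {t : ℝ}, t ∈ Ico (0 : ℝ) 1 →
      HasDerivWithinAt γ γ' (Icc 0 1) t → HasDerivWithinAt γ γ' (Ici t) t := fun ht hγ ↦
    hγ.mono_of_mem_nhdsWithin
      (mem_of_superset (Icc_mem_nhdsGE ht.2) (Icc_subset_Icc_left ht.1))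
  have key := dist_le_of_approx_trajectories_ODE_of_mem
    (v := fun t y ↦ F (x₀ + t • (h + k), y) (h + k)) (s := fun _ ↦ closedBall y₀ a)
    (K := L * ⟨a, ha⟩) (a := 0) (b := 1) (f := β) (g := ψ) (εf := 0) (δ := 0)
    (εg := (L * (1 + K) + C * (1 + K) ^ 2 * a) * ‖k‖ ^ 2)
    (f' := fun t ↦ F (x₀ + t • (h + k), β t) (h + k))
    (hf := fun t ht ↦ (hβ t ht).continuousWithinAt)
    (hg := fun t ht ↦ (hψ' t ht).continuousWithinAt)
    (hf' := fun t ht ↦ hIci ht (hβ t ⟨ht.1, ht.2.le⟩))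
    (hg' := fun t ht ↦ hIci ht (hψ' t ⟨ht.1, ht.2.le⟩))
    (hfs := fun t ht ↦ mem_closedBall_iff_norm.2
      ((hβm t ⟨ht.1, ht.2.le⟩).trans (by linarith)))
    (hgs := fun t ht ↦ mem_closedBall_iff_norm.2 (hψm t ⟨ht.1, ht.2.le⟩))
    (f_bound := fun t ht ↦ by simp)
    (ha := by simp [hβ0, ψ, hα0]) ?_ ?_ 1 ⟨zero_le_one, le_rfl⟩
  · have e : β 1 - α 1 - F (x₀ + h, α 1) k = β 1 - ψ 1 := by simp [ψ, z, sub_sub]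
    rw [e, ← dist_eq_norm]
    rw [zero_add, sub_zero, gronwallBound_zero_mul] at key
    exact key
  · intro t ht
    have ht' : t ∈ Icc (0 : ℝ) 1 := ⟨ht.1, ht.2.le⟩
    refine LipschitzOnWith.of_dist_le_mul fun y hy y' hy' ↦ ?_
    have h1 := hB.lipschitz.norm_sub_le
      (mem_closedBall_add_smul (x₀ := x₀) hhk (mem_closedBall_iff_norm.1 hy) ht')
      (mem_closedBall_add_smul (x₀ := x₀) hhk (mem_closedBall_iff_norm.1 hy') ht')
    have h2 : ‖((x₀ + t • (h + k), y) : E × G) - (x₀ + t • (h + k), y')‖ = ‖y - y'‖ := by simp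
    rw [h2] at h1
    rw [dist_eq_norm, dist_eq_norm, ← sub_apply]
    refine (ContinuousLinearMap.le_opNorm _ _).trans ?_
    calc _ ≤ L * ‖y - y'‖ * a := by gcongr
      _ = L * a * ‖y - y'‖ := by ring
  · intro t ht
    have ht' : t ∈ Icc (0 : ℝ) 1 := ⟨ht.1, ht.2.le⟩
    let δ : E × G := (t • k, t • F (z t) k)
    have hFk : ‖F (z t) k‖ ≤ K * ‖k‖ := (F (z t)).le_of_opNorm_le (hB.norm_le _ (hz t ht')) k
    have hδ : ‖δ‖ ≤ (1 + K) * ‖k‖ := by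
      have hk := norm_nonneg k
      have hKk : 0 ≤ K * ‖k‖ := by positivity
      refine norm_prod_le_iff.2 ⟨?_, ?_⟩ <;> simp only [δ, norm_smul, Real.norm_of_nonneg ht.1]
      · nlinarith [ht.1, ht.2]
      · nlinarith [ht.1, ht.2, norm_nonneg (F (z t) k)]
    have hzδ : (x₀ + t • (h + k), ψ t) = z t + δ := by
      simp [z, δ, ψ, smul_add, add_assoc]
    have hT := hB.taylor (hz t ht') (z' := z t + δ)
      (by rw [← hzδ]; exact mem_closedBall_add_smul hhk (hψm t ht') ht')
    rw [add_sub_cancel_left] at hT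
    have hδ' : δ = t • (k, F (z t) k) := rfl
    -- the defect of `ψ` as a solution of the equation of `β`
    have e : F (z t) h + (t • (fderiv ℝ F (z t) (h, F (z t) h)) k + (1 : ℝ) • F (z t) k) -
        F (z t + δ) (h + k) =
        -(fderiv ℝ F (z t) δ k) - (F (z t + δ) - F (z t) - fderiv ℝ F (z t) δ) (h + k) := by
      have h1 : fderiv ℝ F (z t) δ h = t • (fderiv ℝ F (z t) (h, F (z t) h)) k := by
        rw [hint _ (hz t ht') h k, hδ', map_smul, smul_apply]
      simp only [sub_apply, map_add, h1, one_smul]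
      abel
    rw [dist_eq_norm, hzδ, e]
    refine (norm_sub_le _ _).trans ?_
    rw [norm_neg]
    have b1 : ‖fderiv ℝ F (z t) δ k‖ ≤ L * ((1 + K) * ‖k‖) * ‖k‖ := by
      refine ((fderiv ℝ F (z t) δ).le_opNorm k).trans ?_
      gcongr
      refine ((fderiv ℝ F (z t)).le_opNorm δ).trans ?_
      gcongr
      exact hB.norm_fderiv_le _ (hz t ht')
    have b2 : ‖(F (z t + δ) - F (z t) - fderiv ℝ F (z t) δ) (h + k)‖ ≤
        C * ((1 + K) * ‖k‖) ^ 2 * a := by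
      refine (ContinuousLinearMap.le_opNorm _ _).trans ?_
      gcongr
      exact hT.trans (by gcongr)
    calc _ ≤ L * ((1 + K) * ‖k‖) * ‖k‖ + C * ((1 + K) * ‖k‖) ^ 2 * a := add_le_add b1 b2
      _ = _ := by ring

end Bounds

/-- **Frobenius theorem for total differential equations**: `Df(x) = F(x, f x)` has a local solution
through every point if `F` satisfies the integrability condition. -/
theorem exists_hasFDerivAt [CompleteSpace G] {F : E × G → E →L[ℝ] G} {x₀ : E} {y₀ : G}
    (hF : ContDiffAt ℝ 2 F (x₀, y₀)) {Ω : Set (E × G)} (hΩ : Ω ∈ 𝓝 (x₀, y₀))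
    (hint : ∀ z ∈ Ω, ∀ v w, fderiv ℝ F z (v, F z v) w = fderiv ℝ F z (w, F z w) v) :
    ∃ r > 0, ∃ f : E → G, f x₀ = y₀ ∧
      ∀ x ∈ ball x₀ r, (x, f x) ∈ Ω ∧ HasFDerivAt f (F (x, f x)) x := by
  obtain ⟨a, ha, K, L, C, hB, hsub⟩ := exists_bounds hF hΩ
  -- radial solutions for `‖h‖ ≤ r` exist up to time one and stay in the ball of radius `a / 2`
  obtain ⟨r, hr, hra, hKr⟩ : ∃ r > 0, r ≤ a ∧ K * r ≤ a / 2 := by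
    refine ⟨min a (a / 2 / (K + 1)), by positivity, min_le_left _ _, ?_⟩
    calc (K : ℝ) * min a (a / 2 / (K + 1)) ≤ (K + 1) * (a / 2 / (K + 1)) := by
          gcongr
          · linarith
          · exact min_le_right _ _
      _ = a / 2 := by field_simp
  have hex : ∀ h : E, ‖h‖ ≤ r → _ := fun h hh ↦
    hB.exists_radial_solution ha (hh.trans hra) ((by gcongr : (K : ℝ) * ‖h‖ ≤ K * r).trans hKr)
  choose! α hα0 hα hαm using hex
  have hmem : ∀ h : E, ‖h‖ ≤ r → (x₀ + h, α h 1) ∈ closedBall (x₀, y₀) a := fun h hh ↦ by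
    have := Bounds.mem_closedBall_add_smul (x₀ := x₀) (hh.trans hra)
      ((hαm h hh 1 ⟨zero_le_one, le_rfl⟩).trans (by linarith)) (t := 1) ⟨zero_le_one, le_rfl⟩
    rwa [one_smul] at this
  refine ⟨r, hr, fun x ↦ α (x - x₀) 1, ?_, fun x hx ↦ ⟨?_, ?_⟩⟩
  -- the solution in the direction `0` is constant
  · have hc : ∀ t ∈ Icc (0 : ℝ) 1, α 0 t = α 0 0 :=
      constant_of_has_deriv_right_zero
        (fun t ht ↦ (hα 0 (by simpa using hr.le) t ht).continuousWithinAt) fun t ht ↦ by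
        have h1 := hα 0 (by simpa using hr.le) t ⟨ht.1, ht.2.le⟩
        rw [map_zero] at h1
        exact h1.mono_of_mem_nhdsWithin
          (mem_of_superset (Icc_mem_nhdsGE ht.2) (Icc_subset_Icc_left ht.1))
    simp only [sub_self]
    rw [hc 1 ⟨zero_le_one, le_rfl⟩, hα0 0 (by simpa using hr.le)]
  · have := hmem (x - x₀) (mem_ball_iff_norm.1 hx).le
    rw [add_sub_cancel] at this
    exact hsub this
  · have hx' := mem_ball_iff_norm.1 hx
    let D := gronwallBound 0 (L * a) (L * (1 + K) + C * (1 + K) ^ 2 * a) 1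
    have hev : ∀ᶠ k in 𝓝 (0 : E), ‖k‖ ≤ r ∧ ‖x - x₀ + k‖ ≤ r := by
      have c1 : Tendsto (fun k : E ↦ ‖k‖) (𝓝 0) (𝓝 0) := by
        simpa using (continuous_norm (E := E)).tendsto 0
      have c2 : Tendsto (fun k : E ↦ ‖x - x₀ + k‖) (𝓝 0) (𝓝 ‖x - x₀‖) := by
        have : Continuous fun k : E ↦ ‖x - x₀ + k‖ := by fun_prop
        simpa using this.tendsto 0
      exact (c1.eventually (ge_mem_nhds hr)).and (c2.eventually (ge_mem_nhds hx'))
    rw [hasFDerivAt_iff_isLittleO_nhds_zero]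
    have hO : (fun k ↦ α (x + k - x₀) 1 - α (x - x₀) 1 - F (x, α (x - x₀) 1) k) =O[𝓝 0]
        fun k : E ↦ ‖k‖ ^ 2 := by
      refine Asymptotics.IsBigO.of_bound D (hev.mono fun k hk ↦ ?_)
      have e : x + k - x₀ = x - x₀ + k := by abel
      have hxx : x₀ + (x - x₀) = x := by abel
      have := hB.norm_radial_sub_le (fun z hz ↦ hint z (hsub hz)) (hx'.le.trans hra)
        (hk.2.trans hra) ((by gcongr; exact hk.1 : (K : ℝ) * ‖k‖ ≤ K * r).trans hKr)
        (hα0 _ hx'.le) (hα0 _ hk.2) (hα _ hx'.le) (hαm _ hx'.le) (hα _ hk.2) (hαm _ hk.2)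
      rw [hxx] at this
      rw [e]
      simpa using this
    exact hO.trans_isLittleO (by simpa using Asymptotics.isLittleO_norm_pow_id (one_lt_two))

/-- Solutions of `Df(x) = F(x, f x)` are as smooth as `F`. -/
theorem contDiffOn_of_hasFDerivAt {F : E × G → E →L[ℝ] G} {f : E → G} {s : Set E}
    {Ω : Set (E × G)} (hs : IsOpen s) (hF : ContDiffOn ℝ ∞ F Ω)
    (hf : ∀ x ∈ s, (x, f x) ∈ Ω ∧ HasFDerivAt f (F (x, f x)) x) : ContDiffOn ℝ ∞ f s := by
  refine contDiffOn_infty.2 fun n ↦ ?_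
  induction n with
  | zero =>
    exact contDiffOn_zero.2 fun x hx ↦ (hf x hx).2.continuousAt.continuousWithinAt
  | succ n ih =>
    push_cast
    refine (contDiffOn_succ_iff_fderiv_of_isOpen hs).2
      ⟨fun x hx ↦ (hf x hx).2.differentiableAt.differentiableWithinAt, by simp, ?_⟩
    refine ContDiffOn.congr ((hF.of_le (mod_cast le_top)).comp (contDiffOn_id.prodMk ih)
      fun x hx ↦ (hf x hx).1) fun x hx ↦ (hf x hx).2.fderiv

variable {L : Type*} [NormedAddCommGroup L] [NormedSpace ℝ L]

/-- **Frobenius theorem** for the kernel of a vector valued form `W` on an open subset `Ω` of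
`E × G` such that `W z` is invertible on `G`. If the exterior derivative of `W` vanishes on this
kernel, then there are local integral submanifolds, which are graphs over `E`. -/
theorem exists_graph_subset_ker [CompleteSpace G] {W : E × G → E × G →L[ℝ] L}
    {Ω : Set (E × G)} (hΩ : IsOpen Ω)
    (hW : ContDiffOn ℝ ∞ W Ω)
    (hV : ∀ z ∈ Ω, ((W z).comp (ContinuousLinearMap.inr ℝ E G)).IsInvertible)
    (hflat : ∀ z ∈ Ω, ∀ ξ η, W z ξ = 0 → W z η = 0 → fderiv ℝ W z ξ η = fderiv ℝ W z η ξ)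
    {x₀ : E} {y₀ : G} (h₀ : (x₀, y₀) ∈ Ω) :
    ∃ r > 0, ∃ f : E → G, f x₀ = y₀ ∧ ContDiffOn ℝ ∞ f (ball x₀ r) ∧
      ∀ x ∈ ball x₀ r, (x, f x) ∈ Ω ∧ ∀ v, W (x, f x) (v, fderiv ℝ f x v) = 0 := by
  let V : E × G → G →L[ℝ] L := fun z ↦ (W z).comp (ContinuousLinearMap.inr ℝ E G)
  let F : E × G → E →L[ℝ] G := fun z ↦
    -((V z).inverse.comp ((W z).comp (ContinuousLinearMap.inl ℝ E G)))
  have hVd : ContDiffOn ℝ ∞ V Ω := hW.clm_comp contDiffOn_const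
  have hF : ContDiffOn ℝ ∞ F Ω := by
    refine ContDiffOn.neg (ContDiffOn.clm_comp (fun z hz ↦ ?_) (hW.clm_comp contDiffOn_const))
    have h1 : ContDiffAt ℝ ∞ ContinuousLinearMap.inverse (V z) := (hV z hz).contDiffAt_map_inverse
    exact h1.comp_contDiffWithinAt z (hVd z hz)
  have hWF : ∀ z ∈ Ω, ∀ v, W z (v, F z v) = 0 := fun z hz v ↦ by
    have h1 : V z ((V z).inverse (W z (v, 0))) = W z (v, 0) := (hV z hz).self_apply_inverse _
    have h2 : ((v, F z v) : E × G) = (v, 0) - (0, (V z).inverse (W z (v, 0))) := by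
      simp [F]
    rw [h2, map_sub, sub_eq_zero]
    exact h1.symm
  have hint : ∀ z ∈ Ω, ∀ v w, fderiv ℝ F z (v, F z v) w = fderiv ℝ F z (w, F z w) v := by
    intro z hz
    have hWz : HasFDerivAt W (fderiv ℝ W z) z :=
      ((hW.contDiffAt (hΩ.mem_nhds hz)).differentiableAt (by simp)).hasFDerivAt
    have hFz : HasFDerivAt F (fderiv ℝ F z) z :=
      ((hF.contDiffAt (hΩ.mem_nhds hz)).differentiableAt (by simp)).hasFDerivAt
    -- differentiate the identity `W z (w, F z w) = 0`
    have key : ∀ v w, W z (0, fderiv ℝ F z (v, F z v) w) =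
        -fderiv ℝ W z (v, F z v) (w, F z w) := by
      intro v w
      have h1 : HasFDerivAt (fun y ↦ W y (w, F y w)) _ z :=
        hWz.clm_apply ((hasFDerivAt_const w z).prodMk (hFz.clm_apply (hasFDerivAt_const w z)))
      have h2 : (fun y ↦ W y (w, F y w)) =ᶠ[𝓝 z] fun _ ↦ 0 :=
        (hΩ.eventually_mem hz).mono fun y hy ↦ hWF y hy w
      have h3 := h1.unique ((hasFDerivAt_const (0 : L) z).congr_of_eventuallyEq h2)
      have h4 := congrArg (fun T ↦ T (v, F z v)) h3
      simp only [add_apply, ContinuousLinearMap.comp_apply, ContinuousLinearMap.flip_apply,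
        zero_apply, ContinuousLinearMap.prod_apply, map_zero, zero_add] at h4
      exact eq_neg_of_add_eq_zero_left h4
    intro v w
    refine (hV z hz).injective ?_
    refine (key v w).trans (Eq.trans ?_ (key w v).symm)
    rw [hflat z hz _ _ (hWF z hz v) (hWF z hz w)]
  obtain ⟨r, hr, f, hf0, hf⟩ := exists_hasFDerivAt
    ((hF.contDiffAt (hΩ.mem_nhds h₀)).of_le (WithTop.coe_le_coe.2 le_top)) (hΩ.mem_nhds h₀) hint
  refine ⟨r, hr, f, hf0, contDiffOn_of_hasFDerivAt isOpen_ball hF hf, fun x hx ↦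
    ⟨(hf x hx).1, fun v ↦ ?_⟩⟩
  rw [(hf x hx).2.fderiv]
  exact hWF _ (hf x hx).1 v

end TotalODE

namespace GaugeTheory

/-! ### Derivatives and forms on the model vector spaces -/

section ModelDerivative

variable {E : Type*} [NormedAddCommGroup E] [NormedSpace ℝ E] {K : Type*} [TopologicalSpace K]
  (I : ModelWithCorners ℝ E K) {N : Type*} [TopologicalSpace N] [ChartedSpace K N]
  {E' : Type*} [NormedAddCommGroup E'] [NormedSpace ℝ E'] {K' : Type*} [TopologicalSpace K']
  (I' : ModelWithCorners ℝ E' K') {N' : Type*} [TopologicalSpace N'] [ChartedSpace K' N']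
  {E'' : Type*} [NormedAddCommGroup E''] [NormedSpace ℝ E''] {K'' : Type*} [TopologicalSpace K'']
  (I'' : ModelWithCorners ℝ E'' K'') {N'' : Type*} [TopologicalSpace N''] [ChartedSpace K'' N'']

/-- The manifold derivative, read as a map between the model vector spaces. Its type does not depend
on the points involved, so that base points can be rewritten freely. -/
def mfd (f : N → N') (x : N) : E →L[ℝ] E' :=
  let D : TangentSpace I x →L[ℝ] TangentSpace I' (f x) := mfderiv I I' f x
  D

/-- A Lie algebra valued `1`-form, read as a family of maps between the model vector spaces. -/
def LieForm.toFun {I : ModelWithCorners ℝ E K}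
    {EH : Type*} [NormedAddCommGroup EH] [NormedSpace ℝ EH]
    {KH : Type*} [TopologicalSpace KH] {IH : ModelWithCorners ℝ EH KH}
    {H : Type*} [TopologicalSpace H] [ChartedSpace KH H] [Group H]
    (A : LieForm I N IH H) (x : N) : E →L[ℝ] EH :=
  let D : TangentSpace I x →L[ℝ] GroupLieAlgebra IH H := A x
  D

variable {I I' I''}

theorem mfd_comp {g : N' → N''} {f : N → N'} {x : N} (hg : MDifferentiableAt I' I'' g (f x))
    (hf : MDifferentiableAt I I' f x) :
    mfd I I'' (g ∘ f) x = (mfd I' I'' g (f x)).comp (mfd I I' f x) :=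
  mfderiv_comp x hg hf

theorem mfd_comp_apply {g : N' → N''} {f : N → N'} {x : N}
    (hg : MDifferentiableAt I' I'' g (f x)) (hf : MDifferentiableAt I I' f x) (v : E) :
    mfd I I'' (fun y ↦ g (f y)) x v = mfd I' I'' g (f x) (mfd I I' f x v) :=
  congrArg (· v) (mfd_comp hg hf)

theorem mfd_id (x : N) : mfd I I (fun y : N ↦ y) x = ContinuousLinearMap.id ℝ E :=
  mfderiv_id

theorem mfd_const (x : N) (c : N') : mfd I I' (fun _ : N ↦ c) x = 0 :=
  mfderiv_const

theorem mfd_congr {f g : N → N'} {x : N} (h : f =ᶠ[𝓝 x] g) : mfd I I' f x = mfd I I' g x :=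
  h.mfderiv_eq

theorem mfd_prodMk {f : N → N'} {g : N → N''} {x : N} (hf : MDifferentiableAt I I' f x)
    (hg : MDifferentiableAt I I'' g x) :
    mfd I (I'.prod I'') (fun y ↦ (f y, g y)) x = (mfd I I' f x).prod (mfd I I'' g x) :=
  hf.mfderiv_prod hg

theorem mfd_eq_fderiv {f : E → E'} {x : E} : mfd 𝓘(ℝ, E) 𝓘(ℝ, E') f x = fderiv ℝ f x :=
  mfderiv_eq_fderiv

theorem mfd_prod_apply {f : N × N' → N''} {p : N × N'}
    (hf : MDifferentiableAt (I.prod I') I'' f p) (v : E × E') :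
    mfd (I.prod I') I'' f p v =
      mfd I I'' (fun z ↦ f (z, p.2)) p.1 v.1 + mfd I' I'' (fun z ↦ f (p.1, z)) p.2 v.2 :=
  mfderiv_prod_eq_add_apply hf

end ModelDerivative

/-! ### The Maurer–Cartan form -/

section MaurerCartan

variable {EH : Type*} [NormedAddCommGroup EH] [NormedSpace ℝ EH]
  {KH : Type*} [TopologicalSpace KH] {IH : ModelWithCorners ℝ EH KH}
  {H : Type*} [TopologicalSpace H] [ChartedSpace KH H] [Group H]

/-- In a trivialisation of the tangent bundle at `1`, the vectors over `1` are unchanged. -/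
theorem trivializationAt_one_snd {q : H} [IsManifold IH 1 H] (hq : q = 1) (w : TangentSpace IH q) :
    ((trivializationAt EH (TangentSpace IH : H → Type _) (1 : H)) ⟨q, w⟩).2 = (w : EH) := by
  subst hq
  exact (tangentBundleCore IH H).coordChange_self (achart KH 1) 1 (mem_achart_source KH 1) w

variable [LieGroup IH ∞ H]

theorem lieGroup_three : LieGroup IH (minSmoothness ℝ 3) H :=
  LieGroup.of_le (n := ∞) (by
    rw [minSmoothness_of_isRCLikeNormedField]; exact WithTop.coe_le_coe.2 le_top)

theorem mdifferentiableAt_mul_left (g h : H) : MDifferentiableAt IH IH (fun a : H ↦ g * a) h :=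
  (contMDiff_mul_left (I := IH) (n := ∞)).mdifferentiableAt (by simp)

theorem mdifferentiableAt_mul_right (g h : H) : MDifferentiableAt IH IH (fun a : H ↦ a * g) h :=
  (contMDiff_mul_right (I := IH) (n := ∞)).mdifferentiableAt (by simp)

theorem mfd_inv_mul_mfd_mul (g h : H) (v : EH) :
    mfd IH IH (fun a : H ↦ g⁻¹ * a) (g * h) (mfd IH IH (fun a : H ↦ g * a) h v) = v := by
  rw [← mfd_comp_apply (mdifferentiableAt_mul_left _ _) (mdifferentiableAt_mul_left _ _)]
  simp [mfd_id]

theorem maurerCartan_mfd_mul (g : H) (v : EH) :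
    (maurerCartan IH : LieForm IH H IH H).toFun g (mfd IH IH (fun a : H ↦ g * a) 1 v) = v := by
  have := mfd_inv_mul_mfd_mul (IH := IH) g 1 v
  rwa [mul_one] at this

theorem mfd_mul_maurerCartan (g : H) (v : EH) :
    mfd IH IH (fun a : H ↦ g * a) 1 ((maurerCartan IH : LieForm IH H IH H).toFun g v) = v := by
  have := mfd_inv_mul_mfd_mul (IH := IH) g⁻¹ g v
  rwa [inv_inv, inv_mul_cancel] at this

/-- The Maurer–Cartan form is `v ↦ D(mul)(0, v)` at `(g⁻¹, g)`, for `v` tangent at `g`; hence it is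
smooth. -/
theorem isSmooth_maurerCartan : (maurerCartan IH : LieForm IH H IH H).IsSmooth IH IH := by
  have S₁ : ContMDiff IH.tangent (IH.tangent.prod IH.tangent) ∞
      (fun v : TangentBundle IH H ↦
        (((⟨v.1⁻¹, 0⟩ : TangentBundle IH H), v) : TangentBundle IH H × TangentBundle IH H)) := by
    refine ContMDiff.prodMk ?_ contMDiff_id
    have h1 : ContMDiff IH IH.tangent ∞ (fun g : H ↦ (⟨g, 0⟩ : TangentBundle IH H)) :=
      Bundle.contMDiff_zeroSection _ _
    exact h1.comp ((contMDiff_inv IH ∞).comp (Bundle.contMDiff_proj _))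
  have S₂ : ContMDiff (IH.tangent.prod IH.tangent) (IH.prod IH).tangent ∞
      (equivTangentBundleProd IH H IH H).symm := contMDiff_equivTangentBundleProd_symm
  have S₃ : ContMDiff (IH.prod IH).tangent IH.tangent ∞
      (tangentMap (IH.prod IH) IH (fun p : H × H ↦ p.1 * p.2)) :=
    (contMDiff_mul IH ∞).contMDiff_tangentMap (by simp)
  have S := (S₃.comp S₂).comp S₁
  have e : ∀ v : TangentBundle IH H,
      ((tangentMap (IH.prod IH) IH (fun p : H × H ↦ p.1 * p.2)) ∘
        (equivTangentBundleProd IH H IH H).symm) ((⟨v.1⁻¹, 0⟩ : TangentBundle IH H), v) =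
      ⟨v.1⁻¹ * v.1, mfd IH IH (fun a : H ↦ v.1⁻¹ * a) v.1 v.2⟩ := by
    intro v
    have hd : MDifferentiableAt (IH.prod IH) IH (fun p : H × H ↦ p.1 * p.2) (v.1⁻¹, v.1) :=
      (contMDiff_mul IH ∞).mdifferentiableAt (by simp)
    have h2 := mfd_prod_apply hd ((0, v.2) : EH × EH)
    rw [map_zero, zero_add] at h2
    exact congrArg (fun w : EH ↦ (⟨v.1⁻¹ * v.1, w⟩ : TangentBundle IH H)) h2
  intro v
  have h1 := (Bundle.contMDiffAt_totalSpace.1 (S v)).2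
  have hb : (((tangentMap (IH.prod IH) IH (fun p : H × H ↦ p.1 * p.2)) ∘
        (equivTangentBundleProd IH H IH H).symm) ((⟨v.1⁻¹, 0⟩ : TangentBundle IH H), v)).1 = 1 := by
    rw [e]; exact inv_mul_cancel _
  refine h1.congr_of_eventuallyEq (Eventually.of_forall fun w ↦ ?_)
  simp only [Function.comp_apply] at hb e ⊢
  rw [hb, e]
  exact (trivializationAt_one_snd (inv_mul_cancel _) _).symm

variable {EN : Type*} [NormedAddCommGroup EN] [NormedSpace ℝ EN]
  {KN : Type*} [TopologicalSpace KN] {IN : ModelWithCorners ℝ EN KN}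
  {N : Type*} [TopologicalSpace N] [ChartedSpace KN N]

theorem isSmooth_invMulD [IsManifold IN ∞ N] {f : N → H} (hf : ContMDiff IN IH ∞ f) :
    (invMulD IN IH f).IsSmooth IN IH :=
  ContMDiff.comp (I' := IH.tangent) (isSmooth_maurerCartan (IH := IH) (H := H))
    (hf.contMDiff_tangentMap (m := ∞) (by simp))

end MaurerCartan

/-! ### Curvature in local coordinates -/

section Coordinates

variable {EN : Type*} [NormedAddCommGroup EN] [NormedSpace ℝ EN]
  {KN : Type*} [TopologicalSpace KN] {IN : ModelWithCorners ℝ EN KN}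
  {N : Type*} [TopologicalSpace N] [ChartedSpace KN N]
  {EH : Type*} [NormedAddCommGroup EH] [NormedSpace ℝ EH]
  {KH : Type*} [TopologicalSpace KH] {IH : ModelWithCorners ℝ EH KH}
  {H : Type*} [TopologicalSpace H] [ChartedSpace KH H] [Group H]
  {E : Type*} [NormedAddCommGroup E] [NormedSpace ℝ E]

/-- A smooth local parametrisation of a manifold by an open subset `U` of a normed space: a smooth
map whose derivative is invertible everywhere on `U`. -/
structure IsLocalParam (IN : ModelWithCorners ℝ EN KN) (φ : E → N) (U : Set E) : Prop where
  isOpen : IsOpen U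
  contMDiffOn : ContMDiffOn 𝓘(ℝ, E) IN ∞ φ U
  isInvertible : ∀ z ∈ U, (mfderiv 𝓘(ℝ, E) IN φ z).IsInvertible

/-- A Lie algebra valued `1`-form, pulled back to the normed space `E` along a map `φ`. -/
def LieForm.coord (A : LieForm IN N IH H) (φ : E → N) (z : E) : E →L[ℝ] EH :=
  (A.toFun (φ z)).comp (mfd 𝓘(ℝ, E) IN φ z)

variable (IH H) in
/-- The bracket of the Lie algebra of `H`, read on the model vector space. -/
def lieBr (v w : EH) : EH :=
  let v' : GroupLieAlgebra IH H := v
  let w' : GroupLieAlgebra IH H := w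
  let r : GroupLieAlgebra IH H := ⁅v', w'⁆
  r

theorem IsLocalParam.contMDiffAt {φ : E → N} {U : Set E} (hφ : IsLocalParam IN φ U) {z : E}
    (hz : z ∈ U) : ContMDiffAt 𝓘(ℝ, E) IN ∞ φ z :=
  hφ.contMDiffOn.contMDiffAt (hφ.isOpen.mem_nhds hz)

theorem IsLocalParam.mdifferentiableAt {φ : E → N} {U : Set E} (hφ : IsLocalParam IN φ U) {z : E}
    (hz : z ∈ U) : MDifferentiableAt 𝓘(ℝ, E) IN φ z :=
  (hφ.contMDiffAt hz).mdifferentiableAt (by simp)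

theorem contDiffOn_coord [FiniteDimensional ℝ E] [IsManifold IN ∞ N] {A : LieForm IN N IH H}
    (hA : A.IsSmooth IN IH) {φ : E → N} {U : Set E} (hU : IsOpen U)
    (hφ : ContMDiffOn 𝓘(ℝ, E) IN ∞ φ U) : ContDiffOn ℝ ∞ (A.coord φ) U := by
  refine contDiffOn_clm_apply.2 fun v ↦ ?_
  have h1 : ContMDiff 𝓘(ℝ, E) 𝓘(ℝ, E).tangent ∞ (fun z : E ↦ (⟨z, v⟩ : TangentBundle 𝓘(ℝ, E) E)) :=
    contMDiff_vectorSpace_iff_contDiff.2 contDiff_const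
  have h2 := hφ.contMDiffOn_tangentMapWithin (m := ∞) (by simp) hU.uniqueMDiffOn
  have h3 : ContMDiffOn 𝓘(ℝ, E) 𝓘(ℝ, EH) ∞ _ U := (ContMDiff.comp_contMDiffOn hA h2).comp
    h1.contMDiffOn (fun z hz ↦ hz)
  refine (contMDiffOn_iff_contDiffOn.1 h3).congr fun z hz ↦ ?_
  have h4 : tangentMapWithin 𝓘(ℝ, E) IN φ U ⟨z, v⟩ = tangentMap 𝓘(ℝ, E) IN φ ⟨z, v⟩ :=
    tangentMapWithin_eq_tangentMap (hU.uniqueMDiffOn z hz)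
      ((hφ.contMDiffAt (hU.mem_nhds hz)).mdifferentiableAt (by simp))
  exact congrArg (fun v : TangentBundle IN N ↦ A.toFun v.1 v.2) h4.symm

theorem mfd_mpullback {φ : E → N} {z : E}
    (hz : (mfderiv 𝓘(ℝ, E) IN φ z).IsInvertible) (X : ∀ y : N, TangentSpace IN y) :
    mfd 𝓘(ℝ, E) IN φ z (VectorField.mpullback 𝓘(ℝ, E) IN φ X z) = X (φ z) :=
  hz.self_apply_inverse _

theorem mfd_injective {φ : E → N} {z : E} (hz : (mfderiv 𝓘(ℝ, E) IN φ z).IsInvertible) :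
    Function.Injective (mfd 𝓘(ℝ, E) IN φ z) := hz.injective

theorem mlieBracket_eq_lieBracket (V W : ∀ x : E, TangentSpace 𝓘(ℝ, E) x) :
    VectorField.mlieBracket 𝓘(ℝ, E) V W = VectorField.lieBracket ℝ V W := by
  rw [← VectorField.mlieBracketWithin_univ, VectorField.mlieBracketWithin_eq_lieBracketWithin]
  exact VectorField.lieBracketWithin_univ

/-- The curvature in a local parametrisation: it is tensorial, and given by the usual formula. -/
theorem curvature_eq [FiniteDimensional ℝ E] [CompleteSpace EN]
    [IsManifold IN ∞ N] {A : LieForm IN N IH H}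
    (hA : A.IsSmooth IN IH) {φ : E → N} {U : Set E} (hφ : IsLocalParam IN φ U) {z : E} (hz : z ∈ U)
    {X Y : ∀ y : N, TangentSpace IN y}
    (hX : ContMDiffAt IN IN.tangent 1 (fun y ↦ (⟨y, X y⟩ : TangentBundle IN N)) (φ z))
    (hY : ContMDiffAt IN IN.tangent 1 (fun y ↦ (⟨y, Y y⟩ : TangentBundle IN N)) (φ z))
    {ξ η : E} (hξ : mfd 𝓘(ℝ, E) IN φ z ξ = X (φ z)) (hη : mfd 𝓘(ℝ, E) IN φ z η = Y (φ z)) :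
    @Eq EH (A.curvature IN IH X Y (φ z))
      (fderiv ℝ (A.coord φ) z ξ η - fderiv ℝ (A.coord φ) z η ξ +
        lieBr IH H (A.coord φ z ξ) (A.coord φ z η)) := by
  have := FiniteDimensional.complete ℝ E
  have hW : DifferentiableAt ℝ (A.coord φ) z :=
    ((contDiffOn_coord hA hφ.isOpen hφ.contMDiffOn).contDiffAt
      (hφ.isOpen.mem_nhds hz)).differentiableAt (by simp)
  -- the derivative of `A(X)` along `ζ`, in terms of the coordinate expression `V` of `X`
  have key : ∀ X : ∀ y : N, TangentSpace IN y,
      ContMDiffAt IN IN.tangent 1 (fun y ↦ (⟨y, X y⟩ : TangentBundle IN N)) (φ z) →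
      ∃ V : E → E, VectorField.mpullback 𝓘(ℝ, E) IN φ X = V ∧
        ∀ ζ, mfd IN 𝓘(ℝ, EH) (fun y ↦ A.toFun y (X y)) (φ z) (mfd 𝓘(ℝ, E) IN φ z ζ) =
          fderiv ℝ (A.coord φ) z ζ (V z) + A.coord φ z (fderiv ℝ V z ζ) := by
    intro X hX
    refine ⟨VectorField.mpullback 𝓘(ℝ, E) IN φ X, rfl, fun ζ ↦ ?_⟩
    have hAX : MDifferentiableAt IN 𝓘(ℝ, EH) (fun y ↦ A.toFun y (X y)) (φ z) :=
      ((ContMDiff.contMDiffAt hA).of_le (by simp)).comp (φ z) hX |>.mdifferentiableAt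
        (by simp)
    rw [← mfd_comp_apply hAX (hφ.mdifferentiableAt hz)]
    have h2 : (fun y ↦ A.toFun (φ y) (X (φ y))) =ᶠ[𝓝 z]
        fun y ↦ A.coord φ y (VectorField.mpullback 𝓘(ℝ, E) IN φ X y) :=
      (hφ.isOpen.eventually_mem hz).mono fun y hy ↦
        (congrArg (A.toFun (φ y)) (mfd_mpullback (hφ.isInvertible y hy) X)).symm
    have h1 := hX.mpullback_vectorField_preimage (hφ.contMDiffAt hz) (hφ.isInvertible z hz)
      (m := 1) (n := ∞) (by rw [one_add_one_eq_two]; exact WithTop.coe_le_coe.2 le_top)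
    have h3 : DifferentiableAt ℝ (fun y ↦ (VectorField.mpullback 𝓘(ℝ, E) IN φ X y : E)) z :=
      (contMDiffAt_vectorSpace_iff_contDiffAt.1 h1).differentiableAt (by simp)
    rw [mfd_congr h2, mfd_eq_fderiv, (hW.hasFDerivAt.clm_apply h3.hasFDerivAt).fderiv]
    exact add_comm _ _
  obtain ⟨V, hV, hV'⟩ := key X hX
  obtain ⟨W, hW, hW'⟩ := key Y hY
  have hVz : V z = ξ := mfd_injective (hφ.isInvertible z hz)
    (by rw [hξ, ← hV]; exact mfd_mpullback (hφ.isInvertible z hz) X)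
  have hWz : W z = η := mfd_injective (hφ.isInvertible z hz)
    (by rw [hη, ← hW]; exact mfd_mpullback (hφ.isInvertible z hz) Y)
  have hbr : (VectorField.mlieBracket IN X Y (φ z) : EN) =
      mfd 𝓘(ℝ, E) IN φ z (fderiv ℝ W z ξ - fderiv ℝ V z η) := by
    have hm : minSmoothness ℝ 2 ≤ ∞ := by
      rw [minSmoothness_of_isRCLikeNormedField]; exact WithTop.coe_le_coe.2 le_top
    have : IsManifold IN (minSmoothness ℝ 2) N := .of_le hm
    have h1 := VectorField.mpullback_mlieBracket (n := ∞) (hX.mdifferentiableAt (by simp))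
      (hY.mdifferentiableAt (by simp)) (hφ.contMDiffAt hz) hm
    rw [hV, hW] at h1
    rw [← hVz, ← hWz]
    exact (mfd_mpullback (hφ.isInvertible z hz) _).symm.trans (congrArg (mfd 𝓘(ℝ, E) IN φ z)
      (h1.trans (congrFun (mlieBracket_eq_lieBracket V W) z)))
  have e1 := hW' ξ
  have e2 := hV' η
  rw [hξ, hWz] at e1
  rw [hη, hVz] at e2
  have e3 : A.toFun (φ z) (VectorField.mlieBracket IN X Y (φ z)) =
      A.coord φ z (fderiv ℝ W z ξ) - A.coord φ z (fderiv ℝ V z η) :=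
    (congrArg (A.toFun (φ z)) hbr).trans (map_sub (A.coord φ z) _ _)
  have e4 : lieBr IH H (A.toFun (φ z) (X (φ z))) (A.toFun (φ z) (Y (φ z))) =
      lieBr IH H (A.coord φ z ξ) (A.coord φ z η) := by
    rw [← hξ, ← hη]; rfl
  have e5 : @Eq EH (A.curvature IN IH X Y (φ z))
      (mfd IN 𝓘(ℝ, EH) (fun y ↦ A.toFun y (Y y)) (φ z) (X (φ z)) -
        mfd IN 𝓘(ℝ, EH) (fun y ↦ A.toFun y (X y)) (φ z) (Y (φ z)) -
        A.toFun (φ z) (VectorField.mlieBracket IN X Y (φ z)) +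
        lieBr IH H (A.toFun (φ z) (X (φ z))) (A.toFun (φ z) (Y (φ z)))) := rfl
  rw [e5, e4, e3, e1, e2]
  abel

variable (IH H) in
/-- The vanishing of the curvature `dW + ½[W, W]` at `z`, for a form `W` on a normed space. -/
def IsFlatAt (W : E → E →L[ℝ] EH) (z : E) : Prop :=
  ∀ ξ η, fderiv ℝ W z ξ η - fderiv ℝ W z η ξ + lieBr IH H (W z ξ) (W z η) = 0

/-- Every tangent vector is the value of a vector field which is smooth at the point. -/
theorem exists_vectorField_eq [CompleteSpace EN] [IsManifold IN ∞ N] (p : N)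
    (w : TangentSpace IN p) :
    ∃ X : ∀ y : N, TangentSpace IN y,
      ContMDiffAt IN IN.tangent ∞ (fun y ↦ (⟨y, X y⟩ : TangentBundle IN N)) p ∧ X p = w := by
  let c : EN := mfd IN 𝓘(ℝ, EN) (extChartAt IN p) p w
  have hi : (mfderiv IN 𝓘(ℝ, EN) (extChartAt IN p) p).IsInvertible :=
    isInvertible_mfderiv_extChartAt (mem_extChartAt_source p)
  have hc : ContMDiffAt 𝓘(ℝ, EN) 𝓘(ℝ, EN).tangent ∞
      (fun z : EN ↦ (⟨z, c⟩ : TangentBundle 𝓘(ℝ, EN) EN)) (extChartAt IN p p) :=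
    contMDiffAt_vectorSpace_iff_contDiffAt.2 contDiffAt_const
  exact ⟨VectorField.mpullback IN 𝓘(ℝ, EN) (extChartAt IN p) (fun _ ↦ c),
    hc.mpullback_vectorField_preimage (n := ∞) contMDiffAt_extChartAt hi (by simp),
    hi.inverse_apply_self w⟩

theorem LieForm.IsFlat.coord [FiniteDimensional ℝ E] [CompleteSpace EN]
    [IsManifold IN ∞ N] {A : LieForm IN N IH H} (hA : A.IsSmooth IN IH) (hF : A.IsFlat IN IH)
    {φ : E → N} {U : Set E} (hφ : IsLocalParam IN φ U) {z : E} (hz : z ∈ U) :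
    IsFlatAt IH H (A.coord φ) z := by
  intro ξ η
  obtain ⟨X, hX, hXz⟩ := exists_vectorField_eq (IN := IN) (φ z) (mfd 𝓘(ℝ, E) IN φ z ξ)
  obtain ⟨Y, hY, hYz⟩ := exists_vectorField_eq (IN := IN) (φ z) (mfd 𝓘(ℝ, E) IN φ z η)
  have h := curvature_eq hA hφ hz (hX.of_le (by simp)) (hY.of_le (by simp)) hXz.symm hYz.symm
  exact h.symm.trans (hF (φ z) X Y hX hY)

theorem isLocalParam_extChartAt_symm [IN.Boundaryless] [IsManifold IN ∞ N] (p : N) :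
    IsLocalParam IN (extChartAt IN p).symm (extChartAt IN p).target := by
  refine ⟨isOpen_extChartAt_target p, contMDiffOn_extChartAt_symm p, fun z hz ↦ ?_⟩
  have := isInvertible_mfderivWithin_extChartAt_symm (I := IN) hz
  rwa [IN.range_eq_univ, mfderivWithin_univ] at this

/-- It suffices to test flatness in one chart around each point. -/
theorem LieForm.isFlat_of_coord [FiniteDimensional ℝ EN] [IN.Boundaryless]
    [IsManifold IN ∞ N] {A : LieForm IN N IH H} (hA : A.IsSmooth IN IH)
    (hF : ∀ p : N, IsFlatAt IH H (A.coord (extChartAt IN p).symm) (extChartAt IN p p)) :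
    A.IsFlat IN IH := by
  intro p X Y hX hY
  have := FiniteDimensional.complete ℝ EN
  have hp := isLocalParam_extChartAt_symm (IN := IN) p
  have hz := mem_extChartAt_target (I := IN) p
  -- the point `q` equals `p`, but not by definition; vector fields are evaluated at either
  obtain ⟨q, hq⟩ : ∃ q, q = (extChartAt IN p).symm (extChartAt IN p p) := ⟨_, rfl⟩
  have hqp : q = p := hq.trans (extChartAt_to_inv p)
  have hX' := hX
  have hY' := hY
  rw [← hqp, hq] at hX' hY'
  have h := (curvature_eq hA hp hz (hX'.of_le (by simp)) (hY'.of_le (by simp))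
    (mfd_mpullback (hp.isInvertible _ hz) X) (mfd_mpullback (hp.isInvertible _ hz) Y)).trans
    (hF p _ _)
  rw [← hq, hqp] at h
  exact h

end Coordinates

/-! ### The Maurer–Cartan equation -/

section MaurerCartanEquation

variable {EH : Type*} [NormedAddCommGroup EH] [NormedSpace ℝ EH]
  {KH : Type*} [TopologicalSpace KH] {IH : ModelWithCorners ℝ EH KH}
  {H : Type*} [TopologicalSpace H] [ChartedSpace KH H] [Group H]

/-- The flatness of a form on a normed space is preserved by pull-back along `C²` maps: the second
derivatives of the map cancel by symmetry. -/
theorem IsFlatAt.pullback {E G : Type*} [NormedAddCommGroup E] [NormedSpace ℝ E]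
    [NormedAddCommGroup G] [NormedSpace ℝ G] {W : G → G →L[ℝ] EH} {g : E → G} {z : E}
    (hW : DifferentiableAt ℝ W (g z)) (hg : ContDiffAt ℝ 2 g z) (hF : IsFlatAt IH H W (g z)) :
    IsFlatAt IH H (fun y ↦ (W (g y)).comp (fderiv ℝ g y)) z := by
  intro ξ η
  have hgd : HasFDerivAt g (fderiv ℝ g z) z := (hg.differentiableAt (by simp)).hasFDerivAt
  have hgd2 : HasFDerivAt (fderiv ℝ g) (fderiv ℝ (fderiv ℝ g) z) z :=
    ((hg.fderiv_right (m := 1) (by norm_num)).differentiableAt (by simp)).hasFDerivAt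
  have h := ((hW.hasFDerivAt.comp z hgd).clm_comp hgd2).fderiv
  have hs : fderiv ℝ (fderiv ℝ g) z ξ η = fderiv ℝ (fderiv ℝ g) z η ξ :=
    (hg.isSymmSndFDerivAt (by simp [minSmoothness_of_isRCLikeNormedField])).eq ξ η
  have := hF (fderiv ℝ g z ξ) (fderiv ℝ g z η)
  simp only [Function.comp_def] at h
  rw [h]
  simp only [add_apply, ContinuousLinearMap.comp_apply,
    ContinuousLinearMap.compL_apply, ContinuousLinearMap.flip_apply, hs]
  rw [← this]
  simp

variable [LieGroup IH ∞ H] [FiniteDimensional ℝ EH]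

/-- The **Maurer–Cartan equation**, in a local parametrisation: it suffices to test it on
left-invariant vector fields, on which the form is constant. -/
theorem isFlatAt_maurerCartan {E : Type*} [NormedAddCommGroup E] [NormedSpace ℝ E]
    [FiniteDimensional ℝ E] {φ : E → H} {U : Set E} (hφ : IsLocalParam IH φ U) {z : E}
    (hz : z ∈ U) : IsFlatAt IH H ((maurerCartan IH : LieForm IH H IH H).coord φ) z := by
  intro ξ η
  have := FiniteDimensional.complete ℝ EH
  have := lieGroup_three (IH := IH) (H := H)
  have : IsManifold IH ∞ H := inferInstance
  let MC : LieForm IH H IH H := maurerCartan IH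
  let X : EH → ∀ g : H, TangentSpace IH g := fun v ↦
    mulInvariantVectorField (v : GroupLieAlgebra IH H)
  have hX : ∀ v, ContMDiffAt IH IH.tangent 1 (fun y ↦ (⟨y, X v y⟩ : TangentBundle IH H)) (φ z) :=
    fun v ↦ (contMDiffAt_mulInvariantVectorField (I := IH) (G := H) v).of_le
      (by rw [minSmoothness_of_isRCLikeNormedField]; exact one_le_two)
  have hXz : ∀ ζ, mfd 𝓘(ℝ, E) IH φ z ζ = X (MC.coord φ z ζ) (φ z) := fun ζ ↦
    (mfd_mul_maurerCartan (IH := IH) (φ z) _).symm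
  have h := curvature_eq isSmooth_maurerCartan hφ hz (hX _) (hX _) (hXz ξ) (hXz η)
  refine h.symm.trans ?_
  have hc : ∀ v, (fun y ↦ MC.toFun y (X v y)) = fun _ ↦ v := fun v ↦
    funext fun y ↦ maurerCartan_mfd_mul y v
  obtain ⟨v, hv⟩ : ∃ v, v = MC.coord φ z ξ := ⟨_, rfl⟩
  obtain ⟨w, hw⟩ : ∃ w, w = MC.coord φ z η := ⟨_, rfl⟩
  have e1 : @Eq EH (MC.curvature IH IH (X v) (X w) (φ z))
      (mfd IH 𝓘(ℝ, EH) (fun y ↦ MC.toFun y (X w y)) (φ z) (X v (φ z)) -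
        mfd IH 𝓘(ℝ, EH) (fun y ↦ MC.toFun y (X v y)) (φ z) (X w (φ z)) -
        MC.toFun (φ z) (VectorField.mlieBracket IH (X v) (X w) (φ z)) +
        lieBr IH H (MC.toFun (φ z) (X v (φ z))) (MC.toFun (φ z) (X w (φ z)))) := rfl
  have e2 : MC.toFun (φ z) (VectorField.mlieBracket IH (X v) (X w) (φ z)) = lieBr IH H v w :=
    (congrArg (MC.toFun (φ z)) (congrFun (mulInvariantVector_mlieBracket (I := IH) (G := H) v w)
      (φ z)).symm).trans (maurerCartan_mfd_mul (φ z) _)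
  have e3 : ∀ v, MC.toFun (φ z) (X v (φ z)) = v := fun v ↦ maurerCartan_mfd_mul (φ z) v
  rw [← hv, ← hw, e1, hc, hc, e2, e3, e3, mfd_const, mfd_const, sub_add_cancel]
  exact sub_self (0 : EH)

variable {EN : Type*} [NormedAddCommGroup EN] [NormedSpace ℝ EN] [FiniteDimensional ℝ EN]
  {KN : Type*} [TopologicalSpace KN] {IN : ModelWithCorners ℝ EN KN} [IN.Boundaryless]
  {N : Type*} [TopologicalSpace N] [ChartedSpace KN N] [IsManifold IN ∞ N]
  [IH.Boundaryless]

/-- The form `f⁻¹ df` of a smooth map `f` is flat, being the pull-back of a flat form. -/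
theorem isFlat_invMulD {f : N → H} (hf : ContMDiff IN IH ∞ f) :
    (invMulD IN IH f).IsFlat IN IH := by
  refine LieForm.isFlat_of_coord (isSmooth_invMulD hf) fun p ↦ ?_
  let φ := (extChartAt IN p).symm
  let ψ := (extChartAt IH (f p)).symm
  let g : EN → EH := fun z ↦ extChartAt IH (f p) (f (φ z))
  let z := extChartAt IN p p
  have hφ := isLocalParam_extChartAt_symm (IN := IN) p
  have hψ := isLocalParam_extChartAt_symm (IN := IH) (f p)
  have hz := mem_extChartAt_target (I := IN) p
  have hφz : φ z = p := extChartAt_to_inv p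
  have hcont : ContinuousAt (fun y ↦ f (φ y)) z :=
    hf.continuous.continuousAt.comp (hφ.contMDiffAt hz).continuousAt
  have hmem : ∀ᶠ y in 𝓝 z, y ∈ (extChartAt IN p).target ∧
      f (φ y) ∈ (extChartAt IH (f p)).source :=
    (hφ.isOpen.eventually_mem hz).and (hcont.eventually_mem (by
      rw [hφz]; exact extChartAt_source_mem_nhds (f p)))
  have hg : ∀ᶠ y in 𝓝 z, ContDiffAt ℝ ∞ g y := hmem.mono fun y hy ↦
    contMDiffAt_iff_contDiffAt.1 ((contMDiffAt_extChartAt' (by simpa using hy.2)).comp y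
      (hf.contMDiffAt.comp y (hφ.contMDiffAt hy.1)))
  have hgz : g z ∈ (extChartAt IH (f p)).target :=
    (extChartAt IH (f p)).map_source hmem.self_of_nhds.2
  have hψg : ∀ᶠ y in 𝓝 z, ψ (g y) = f (φ y) := hmem.mono fun y hy ↦
    (extChartAt IH (f p)).left_inv hy.2
  let W := (maurerCartan IH : LieForm IH H IH H).coord ψ
  have hW : DifferentiableAt ℝ W (g z) :=
    ((contDiffOn_coord isSmooth_maurerCartan hψ.isOpen hψ.contMDiffOn).contDiffAt
      (hψ.isOpen.mem_nhds hgz)).differentiableAt (by simp)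
  have key : (invMulD IN IH f).coord φ =ᶠ[𝓝 z] fun y ↦ (W (g y)).comp (fderiv ℝ g y) := by
    filter_upwards [hψg.eventually_nhds, hmem, hg] with y h1 h2 h3
    have h4 : mfd 𝓘(ℝ, EN) IH (fun y ↦ f (φ y)) y =
        (mfd 𝓘(ℝ, EH) IH ψ (g y)).comp (fderiv ℝ g y) := by
      rw [← mfd_congr h1, ← mfd_eq_fderiv]
      exact mfd_comp (hψ.mdifferentiableAt ((extChartAt IH (f p)).map_source h2.2))
        (h3.differentiableAt (by simp)).mdifferentiableAt
    have h5 : mfd 𝓘(ℝ, EN) IH (fun y ↦ f (φ y)) y =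
        (mfd IN IH f (φ y)).comp (mfd 𝓘(ℝ, EN) IN φ y) :=
      mfd_comp (hf.mdifferentiable (by simp) _) (hφ.mdifferentiableAt h2.1)
    have h6 : (invMulD IN IH f).coord φ y =
        ((maurerCartan IH : LieForm IH H IH H).toFun (f (φ y))).comp
          ((mfd IN IH f (φ y)).comp (mfd 𝓘(ℝ, EN) IN φ y)) := rfl
    rw [h6, ← h5, h4, ← h1.self_of_nhds]
    rfl
  have hflat := (isFlatAt_maurerCartan hψ hgz).pullback hW (hg.self_of_nhds.of_le
    (WithTop.coe_le_coe.2 le_top))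
  intro ξ η
  rw [key.fderiv_eq, key.self_of_nhds]
  exact hflat ξ η

end MaurerCartanEquation

/-! ### Connection forms and dressing fields -/

section Bundle

variable {EM : Type*} [NormedAddCommGroup EM] [NormedSpace ℝ EM]
  {KM : Type*} [TopologicalSpace KM] {IM : ModelWithCorners ℝ EM KM}
  {M : Type*} [TopologicalSpace M] [ChartedSpace KM M]
  {EH : Type*} [NormedAddCommGroup EH] [NormedSpace ℝ EH]
  {KH : Type*} [TopologicalSpace KH] {IH : ModelWithCorners ℝ EH KH}
  {H : Type*} [TopologicalSpace H] [ChartedSpace KH H] [Group H]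
  {EP : Type*} [NormedAddCommGroup EP] [NormedSpace ℝ EP]
  {KP : Type*} [TopologicalSpace KP] {IP : ModelWithCorners ℝ EP KP}
  {P : Type*} [TopologicalSpace P] [ChartedSpace KP P] [MulAction Hᵐᵒᵖ P] {π : P → M}
  {EN : Type*} [NormedAddCommGroup EN] [NormedSpace ℝ EN]
  {KN : Type*} [TopologicalSpace KN] {IN : ModelWithCorners ℝ EN KN}
  {N : Type*} [TopologicalSpace N] [ChartedSpace KN N]

/-- The Maurer–Cartan form, read on the model vector space. -/
local notation "mc" => LieForm.toFun (maurerCartan IH : LieForm IH H IH H)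

open MulOpposite

variable (IH) in
/-- The adjoint action, read on the model vector space. -/
def adj (h : H) : EH →L[ℝ] EH :=
  let D : GroupLieAlgebra IH H →L[ℝ] GroupLieAlgebra IH H := Ad IH h
  D

theorem op_mul_smul {P H : Type*} [Group H] [MulAction Hᵐᵒᵖ P] (p : P) (h k : H) :
    op (h * k) • p = op k • op h • p := by
  rw [op_mul, mul_smul]

theorem contMDiff_smul_right
    (hact : ContMDiff (IP.prod IH) IP ∞ (fun z : P × H ↦ op z.2 • z.1)) (h : H) :
    ContMDiff IP IP ∞ (fun p : P ↦ op h • p) :=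
  hact.comp (contMDiff_id.prodMk contMDiff_const)

theorem contMDiff_orbit
    (hact : ContMDiff (IP.prod IH) IP ∞ (fun z : P × H ↦ op z.2 • z.1)) (p : P) :
    ContMDiff IH IP ∞ (fun h : H ↦ op h • p) :=
  hact.comp (contMDiff_const.prodMk contMDiff_id)

theorem IsDressingField.inv_equivariant {u : P → H} (hu : IsDressingField IH IP u) (p : P) (h : H) :
    (u (op h • p))⁻¹ = (u p)⁻¹ * h := by
  rw [hu.equivariant, mul_inv_rev, inv_inv]

variable [LieGroup IH ∞ H]

/-- `R_h^* ω_H = Ad_{h⁻¹} ω_H` for the Maurer–Cartan form. -/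
theorem maurerCartan_mfd_mul_right (g h : H) (v : EH) :
    mc (g * h) (mfd IH IH (fun x ↦ x * h) g v) = adj IH h⁻¹ (mc g v) := by
  obtain ⟨w, rfl⟩ : ∃ w, v = mfd IH IH (fun a : H ↦ g * a) 1 w :=
    ⟨_, (mfd_mul_maurerCartan g v).symm⟩
  rw [maurerCartan_mfd_mul]
  have h1 : mfd IH IH (fun x ↦ g * x * h) 1 w =
      mfd IH IH (fun x ↦ x * h) g (mfd IH IH (fun a : H ↦ g * a) 1 w) := by
    have := mfd_comp_apply (mdifferentiableAt_mul_right (IH := IH) h (g * 1))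
      (mdifferentiableAt_mul_left g 1) w
    rwa [mul_one] at this
  have hd : MDifferentiableAt IH IH (fun x ↦ g * x * h) 1 :=
    (mdifferentiableAt_mul_right h (g * 1)).comp 1 (mdifferentiableAt_mul_left g 1)
  have h2 := mfd_comp_apply (f := fun x ↦ g * x * h)
    (mdifferentiableAt_mul_left (IH := IH) (g * h)⁻¹ (g * 1 * h)) hd w
  rw [h1, mul_one] at h2
  have h3 : (fun x ↦ (g * h)⁻¹ * (g * x * h)) = fun x ↦ h⁻¹ * x * h⁻¹⁻¹ := by
    funext x; group
  rw [h3] at h2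
  exact h2.symm

/-- The derivative of the orbit map `k ↦ p k` at `h` sends a vector `w` to the fundamental vector at
`p h` generated by `ω_H(w)`. -/
theorem mfd_orbit (hact : ContMDiff (IP.prod IH) IP ∞ (fun z : P × H ↦ op z.2 • z.1))
    (p : P) (h : H) (w : EH) :
    mfd IH IP (fun k : H ↦ op k • p) h w =
      mfd IH IP (fun k : H ↦ op k • op h • p) 1 (mc h w) := by
  have hd := ((contMDiff_orbit hact (op h • p)).mdifferentiable (by simp) (h⁻¹ * h))
  have h1 := mfd_comp_apply hd (mdifferentiableAt_mul_left h⁻¹ h) w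
  rw [inv_mul_cancel] at h1
  refine Eq.trans ?_ h1
  congr 2
  funext k
  rw [← op_mul_smul, mul_inv_cancel_left]

/-- The product rule for connection forms:
`A(d(f·h)) = Ad_{h⁻¹} A(df) + h⁻¹ dh` for maps `f` to the bundle and `h` to the group. -/
theorem IsConnectionForm.toFun_mfd_smul
    (hact : ContMDiff (IP.prod IH) IP ∞ (fun z : P × H ↦ op z.2 • z.1))
    [IsManifold IP 1 P] {A : LieForm IP P IH H}
    (hA : IsConnectionForm IH IP A) {f : N → P} {h : N → H} {x : N}
    (hf : MDifferentiableAt IN IP f x) (hh : MDifferentiableAt IN IH h x) (v : EN) :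
    A.toFun (op (h x) • f x) (mfd IN IP (fun y ↦ op (h y) • f y) x v) =
      adj IH (h x)⁻¹ (A.toFun (f x) (mfd IN IP f x v)) + mc (h x) (mfd IN IH h x v) := by
  have hd := hact.mdifferentiable (by simp) (f x, h x)
  have h1 := mfd_comp_apply (f := fun y ↦ (f y, h y)) hd (hf.prodMk hh) v
  have h2 := mfd_prod_apply hd (mfd IN IP f x v, mfd IN IH h x v)
  rw [mfd_prodMk hf hh] at h1
  have h3 := h1.trans h2
  simp only at h3
  rw [h3, map_add, mfd_orbit hact]
  have e1 : A.toFun (op (h x) • f x) (mfd IP IP (fun z ↦ op (h x) • z) (f x) (mfd IN IP f x v)) =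
      adj IH (h x)⁻¹ (A.toFun (f x) (mfd IN IP f x v)) :=
    congrArg (fun B : LieForm IP P IH H ↦ B.toFun (f x) (mfd IN IP f x v)) (hA.equivariant (h x))
  have e2 : A.toFun (op (h x) • f x) (mfd IH IP (fun k : H ↦ op k • op (h x) • f x) 1
      (mc (h x) (mfd IN IH h x v))) = mc (h x) (mfd IN IH h x v) :=
    hA.vertical (op (h x) • f x) _
  rw [e1, e2]

theorem IsDressingField.inv_smooth {u : P → H} (hu : IsDressingField IH IP u) :
    ContMDiff IP IH ∞ (fun p ↦ (u p)⁻¹) := hu.smooth.inv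

/-- By equivariance, `p ↦ u(p)⁻¹` restricts to a left translation on each orbit, and it intertwines
the right translations; so `u du⁻¹` inherits both properties from the Maurer–Cartan form. -/
theorem IsDressingField.isConnectionForm
    (hact : ContMDiff (IP.prod IH) IP ∞ (fun z : P × H ↦ op z.2 • z.1))
    [IsManifold IP ∞ P] {u : P → H}
    (hu : IsDressingField IH IP u) : IsConnectionForm IH IP (pureGauge IP IH u) := by
  have hg := hu.inv_smooth
  have hgd := hg.mdifferentiable (by simp)
  refine ⟨isSmooth_invMulD hg, fun p X ↦ ?_,
    fun h ↦ funext fun p ↦ ContinuousLinearMap.ext fun v ↦ ?_⟩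
  · have h1 := mfd_comp_apply (hgd _)
      ((contMDiff_orbit hact p).mdifferentiable (by simp) 1) X
    simp only [hu.inv_equivariant, op_one, one_smul] at h1
    exact (congrArg (mc (u p)⁻¹) h1.symm).trans (maurerCartan_mfd_mul _ _)
  · have h1 := mfd_comp_apply (hgd _) ((contMDiff_smul_right hact h).mdifferentiable (by simp) p) v
    simp only [hu.inv_equivariant] at h1
    have h2 := mfd_comp_apply (mdifferentiableAt_mul_right (IH := IH) h _) (hgd p) v
    have h3 : mc (u (op h • p))⁻¹ (mfd IP IH (fun y ↦ (u y)⁻¹) (op h • p)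
        (mfd IP IP (fun p : P ↦ op h • p) p v)) =
        adj IH h⁻¹ (mc (u p)⁻¹ (mfd IP IH (fun y ↦ (u y)⁻¹) p v)) := by
      rw [← h1, h2, hu.inv_equivariant, maurerCartan_mfd_mul_right]
    exact h3

end Bundle

/-! ### Sections and trivialisations of principal bundles -/

section Bundle

variable {EM : Type*} [NormedAddCommGroup EM] [NormedSpace ℝ EM]
  {KM : Type*} [TopologicalSpace KM] {IM : ModelWithCorners ℝ EM KM}
  {M : Type*} [TopologicalSpace M] [ChartedSpace KM M]
  {EH : Type*} [NormedAddCommGroup EH] [NormedSpace ℝ EH]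
  {KH : Type*} [TopologicalSpace KH] {IH : ModelWithCorners ℝ EH KH}
  {H : Type*} [TopologicalSpace H] [ChartedSpace KH H] [Group H]
  {EP : Type*} [NormedAddCommGroup EP] [NormedSpace ℝ EP]
  {KP : Type*} [TopologicalSpace KP] {IP : ModelWithCorners ℝ EP KP}
  {P : Type*} [TopologicalSpace P] [ChartedSpace KP P] [MulAction Hᵐᵒᵖ P] {π : P → M}
  {EN : Type*} [NormedAddCommGroup EN] [NormedSpace ℝ EN]
  {KN : Type*} [TopologicalSpace KN] {IN : ModelWithCorners ℝ EN KN}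
  {N : Type*} [TopologicalSpace N] [ChartedSpace KN N]

open MulOpposite

theorem invMulD_comp {EP : Type*} [NormedAddCommGroup EP] [NormedSpace ℝ EP]
    {KP : Type*} [TopologicalSpace KP] {IP : ModelWithCorners ℝ EP KP}
    {P : Type*} [TopologicalSpace P] [ChartedSpace KP P] {f : N → P} {g : P → H}
    (hg : ContMDiff IP IH ∞ g) (hf : ContMDiff IN IP ∞ f) :
    LieForm.pullback IN IP IH f (invMulD IP IH g) = invMulD IN IH (g ∘ f) :=
  funext fun x ↦ ContinuousLinearMap.ext fun v ↦
    congrArg ((maurerCartan IH : LieForm IH H IH H).toFun (g (f x)))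
      (mfd_comp_apply (hg.mdifferentiable (by simp) _) (hf.mdifferentiable (by simp) x) v).symm

namespace IsPrincipalBundle

theorem exists_smul_eq (hπ : IsPrincipalBundle IM IH H IP π) {p q : P} (h : π p = π q) :
    ∃ k : H, op k • p = q := by
  obtain ⟨e, hx, -, -, he⟩ := hπ.exists_trivialization (π p)
  have hp : p ∈ e.source := e.mem_source.2 hx
  have hq : q ∈ e.source := e.mem_source.2 (h ▸ hx)
  have hpk : ∀ k : H, op k • p ∈ e.source := fun k ↦ e.mem_source.2 (by rwa [hπ.proj_act])
  refine ⟨(e p).2⁻¹ * (e q).2, e.injOn (hpk _) hq (show e _ = e q from Prod.ext ?_ ?_)⟩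
  · rw [e.coe_fst (hpk _), e.coe_fst hq, hπ.proj_act, h]
  · rw [he p hp, mul_inv_cancel_left]

theorem smul_injective (hπ : IsPrincipalBundle IM IH H IP π) {p : P} {h k : H}
    (hk : op h • p = op k • p) : h = k := by
  obtain ⟨e, hx, -, -, he⟩ := hπ.exists_trivialization (π p)
  have hp : p ∈ e.source := e.mem_source.2 hx
  have := congrArg (fun q ↦ (e q).2) hk
  simp only [he p hp] at this
  exact mul_left_cancel this

theorem exists_localSection (hπ : IsPrincipalBundle IM IH H IP π) (x : M) :
    ∃ (U : Set M) (s : M → P), IsOpen U ∧ x ∈ U ∧ ContMDiffOn IM IP ∞ s U ∧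
      ∀ y ∈ U, π (s y) = y := by
  obtain ⟨e, hx, -, hs, -⟩ := hπ.exists_trivialization x
  refine ⟨e.baseSet, fun y ↦ e.toOpenPartialHomeomorph.symm (y, 1), e.open_baseSet, hx, ?_,
    fun y hy ↦ e.proj_symm_apply' hy⟩
  exact hs.comp (contMDiff_id.prodMk contMDiff_const).contMDiffOn
    fun y hy ↦ e.mem_target.2 hy

end IsPrincipalBundle

/-- A smooth local section `σ` determines the smooth map `g` with `p = σ(π p) g(p)`. -/
theorem IsPrincipalBundle.exists_division [LieGroup IH ∞ H]
    (hπ : IsPrincipalBundle IM IH H IP π) {σ : M → P} {U : Set M} (hU : IsOpen U)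
    (hσ : ContMDiffOn IM IP ∞ σ U) (hσπ : ∀ x ∈ U, π (σ x) = x) :
    ∃ g : P → H, ContMDiffOn IP IH ∞ g (π ⁻¹' U) ∧ ∀ p ∈ π ⁻¹' U, op (g p) • σ (π p) = p := by
  have hex : ∀ p ∈ π ⁻¹' U, ∃ k : H, op k • σ (π p) = p := fun p hp ↦ hπ.exists_smul_eq (hσπ _ hp)
  choose! g hg using hex
  have hπc : Continuous π := hπ.contMDiff_proj.continuous
  refine ⟨g, fun p hp ↦ ContMDiffAt.contMDiffWithinAt ?_, hg⟩
  obtain ⟨e, hx, hes, -, he⟩ := hπ.exists_trivialization (π p)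
  let O := U ∩ e.baseSet
  have hO : π ⁻¹' O ∈ 𝓝 p := ((hU.inter e.open_baseSet).preimage hπc).mem_nhds ⟨hp, hx⟩
  have hs : ContMDiffOn IP IH ∞ (fun q ↦ (e q).2) (π ⁻¹' O) :=
    contMDiff_snd.comp_contMDiffOn (hes.mono fun q hq ↦ e.mem_source.2 hq.2)
  have hs' : ContMDiffOn IP IH ∞ (fun q ↦ (e (σ (π q))).2) (π ⁻¹' O) :=
    hs.comp (hσ.comp hπ.contMDiff_proj.contMDiffOn fun q hq ↦ hq.1) fun q hq ↦ by
      simpa only [mem_preimage, Function.comp_apply, hσπ _ hq.1] using hq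
  refine ((hs'.inv.mul hs).contMDiffAt hO).congr_of_eventuallyEq (mem_of_superset hO fun q hq ↦ ?_)
  have h1 := he (σ (π q)) (e.mem_source.2 (by rw [hσπ _ hq.1]; exact hq.2)) (g q)
  rw [hg q hq.1] at h1
  simp only [mem_ofPred_eq, h1, Pi.mul_apply, inv_mul_cancel_left]

namespace IsDressingField

theorem apply_smul_self {u : P → H} (hu : IsDressingField IH IP u) (p : P) :
    u (op (u p) • p) = 1 := by
  rw [hu.equivariant, inv_mul_cancel]

/-- The map `p ↦ p u(p)` is constant on the fibres, and so defines a global section, which is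
smooth as local smooth sections exist. -/
theorem exists_section [LieGroup IH ∞ H] (hπ : IsPrincipalBundle IM IH H IP π) {u : P → H}
    (hu : IsDressingField IH IP u) :
    ∃ σ : M → P, ContMDiff IM IP ∞ σ ∧ (∀ x, π (σ x) = x) ∧ ∀ p, σ (π p) = op (u p) • p := by
  have huniq : ∀ p q : P, π p = π q → op (u p) • p = op (u q) • q := by
    intro p q hpq
    obtain ⟨k, rfl⟩ := hπ.exists_smul_eq hpq
    rw [← op_mul_smul, hu.equivariant, mul_inv_cancel_left]
  have hex : ∀ x, ∃ p, π p = x := fun x ↦ by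
    obtain ⟨U, s, -, hx, -, hs⟩ := hπ.exists_localSection x
    exact ⟨s x, hs x hx⟩
  choose τ hτ using hex
  refine ⟨fun x ↦ op (u (τ x)) • τ x, fun x ↦ ?_, fun x ↦ by rw [hπ.proj_act, hτ],
    fun p ↦ huniq _ _ (hτ _)⟩
  obtain ⟨U, s, hU, hx, hs, hsπ⟩ := hπ.exists_localSection x
  have h1 : ContMDiffOn IM IP ∞ (fun y ↦ op (u (s y)) • s y) U :=
    hπ.contMDiff_act.comp_contMDiffOn (hs.prodMk (hu.smooth.comp_contMDiffOn hs))
  exact (h1.contMDiffAt (hU.mem_nhds hx)).congr_of_eventuallyEq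
    (mem_of_superset (hU.mem_nhds hx) fun y hy ↦ huniq _ _ ((hτ y).trans (hsπ y hy).symm))

/-- The inverse of `p ↦ (π p, u(p)⁻¹)` is `(x, h) ↦ σ(x) h`, where `σ` is the section on which
`u` equals `1`. -/
theorem exists_trivialisation [LieGroup IH ∞ H] (hπ : IsPrincipalBundle IM IH H IP π) {u : P → H}
    (hu : IsDressingField IH IP u) :
    ∃ φ : P ≃ₘ^∞⟮IP, IM.prod IH⟯ (M × H), IsTrivialisation IM IH IP π φ ∧
      (∀ p, φ p = (π p, (u p)⁻¹)) ∧
      pureGauge IP IH u = LieForm.pullback IP (IM.prod IH) IH φ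
        (LieForm.pullback (IM.prod IH) IH IH (Prod.snd : M × H → H) (maurerCartan IH)) := by
  obtain ⟨σ, hσ, hσπ, hσu⟩ := hu.exists_section hπ
  let φ : P ≃ₘ^∞⟮IP, IM.prod IH⟯ (M × H) :=
    { toFun := fun p ↦ (π p, (u p)⁻¹)
      invFun := fun z ↦ op z.2 • σ z.1
      left_inv := fun p ↦ by
        simp only
        rw [hσu, ← op_mul_smul, mul_inv_cancel, op_one, one_smul]
      right_inv := fun z ↦ by
        have h1 : u (σ z.1) = 1 := by
          have := hu.apply_smul_self (σ z.1)
          rwa [← hσu, hσπ] at this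
        refine Prod.ext ?_ ?_
        · simp only [hπ.proj_act, hσπ]
        · simp only [hu.inv_equivariant, h1, inv_one, one_mul]
      contMDiff_toFun := hπ.contMDiff_proj.prodMk hu.inv_smooth
      contMDiff_invFun := hπ.contMDiff_act.comp ((hσ.comp contMDiff_fst).prodMk contMDiff_snd) }
  refine ⟨φ, ⟨fun p ↦ rfl, fun p h ↦ Prod.ext (hπ.proj_act p h) (hu.inv_equivariant p h)⟩,
    fun p ↦ rfl, ?_⟩
  refine funext fun p ↦ ContinuousLinearMap.ext fun v ↦ ?_
  exact congrArg ((maurerCartan IH : LieForm IH H IH H).toFun (u p)⁻¹)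
    (mfd_comp_apply (f := φ) (g := (Prod.snd : M × H → H)) mdifferentiableAt_snd
      (φ.contMDiff.mdifferentiable (by simp) p) v)

end IsDressingField

/-! ### Gauge transformations -/

section Gauge

variable {γ : P → H} {u : P → H}

theorem IsGaugeElement.contMDiff_gaugeMap (hπ : IsPrincipalBundle IM IH H IP π)
    (hγ : IsGaugeElement IH IP γ) : ContMDiff IP IP ∞ (gaugeMap γ) :=
  hπ.contMDiff_act.comp (contMDiff_id.prodMk hγ.smooth)

theorem IsDressingField.comp_gaugeMap (hu : IsDressingField IH IP u) :
    u ∘ gaugeMap γ = fun p ↦ (γ p)⁻¹ * u p :=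
  funext fun p ↦ hu.equivariant p (γ p)

variable [LieGroup IH ∞ H]

theorem IsDressingField.gauge (hu : IsDressingField IH IP u) (hγ : IsGaugeElement IH IP γ) :
    IsDressingField IH IP (fun p ↦ (γ p)⁻¹ * u p) :=
  ⟨hγ.smooth.inv.mul hu.smooth, fun p h ↦ by rw [hγ.equivariant, hu.equivariant]; group⟩

/-- The gauge transform of a connection form `A` is `Ad_{γ⁻¹} A + γ⁻¹ dγ`. -/
theorem IsConnectionForm.pullback_gaugeMap [IsManifold IP 1 P]
    (hπ : IsPrincipalBundle IM IH H IP π) {A : LieForm IP P IH H}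
    (hA : IsConnectionForm IH IP A) (hγ : IsGaugeElement IH IP γ) :
    LieForm.pullback IP IP IH (gaugeMap γ) A =
      fun p ↦ (Ad IH (γ p)⁻¹).comp (A p) + invMulD IP IH γ p := by
  refine funext fun p ↦ ContinuousLinearMap.ext fun v ↦ ?_
  have h := hA.toFun_mfd_smul hπ.contMDiff_act (f := fun q : P ↦ q) (h := γ) (x := p)
    mdifferentiableAt_id (hγ.smooth.mdifferentiable (by simp) p) v
  rw [mfd_id] at h
  exact h

theorem pullback_gaugeMap_sub [IsManifold IP ∞ P]
    (hπ : IsPrincipalBundle IM IH H IP π) {A B : LieForm IP P IH H}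
    (hA : IsConnectionForm IH IP A) (hB : IsConnectionForm IH IP B) (hγ : IsGaugeElement IH IP γ) :
    LieForm.pullback IP IP IH (gaugeMap γ) (fun p ↦ A p - B p) =
      fun p ↦ (Ad IH (γ p)⁻¹).comp (A p - B p) := by
  refine funext fun p ↦ ContinuousLinearMap.ext fun v ↦ ?_
  have h1 := congrArg (fun C : LieForm IP P IH H ↦ C.toFun p v) (hA.pullback_gaugeMap hπ hγ)
  have h2 := congrArg (fun C : LieForm IP P IH H ↦ C.toFun p v) (hB.pullback_gaugeMap hπ hγ)
  have h3 := congrArg₂ (fun a b : EH ↦ a - b) h1 h2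
  refine h3.trans ?_
  refine (add_sub_add_right_eq_sub (adj IH (γ p)⁻¹ (A.toFun p v)) (adj IH (γ p)⁻¹ (B.toFun p v))
    ((invMulD IP IH γ).toFun p v)).trans ?_
  exact (map_sub (adj IH (γ p)⁻¹) _ _).symm

end Gauge

end Bundle

/-! ### Maps with vanishing differential -/

section Const

variable {EN : Type*} [NormedAddCommGroup EN] [NormedSpace ℝ EN]
  {KN : Type*} [TopologicalSpace KN] {IN : ModelWithCorners ℝ EN KN} [IN.Boundaryless]
  {N : Type*} [TopologicalSpace N] [ChartedSpace KN N] [IsManifold IN ∞ N]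
  {EH : Type*} [NormedAddCommGroup EH] [NormedSpace ℝ EH]
  {KH : Type*} [TopologicalSpace KH] {IH : ModelWithCorners ℝ EH KH}
  {H : Type*} [TopologicalSpace H] [ChartedSpace KH H] [IsManifold IH ∞ H]

/-- A map with vanishing differential is locally constant. -/
theorem eventually_eq_of_mfd_eq_zero {f : N → H} {U : Set N} (hU : IsOpen U)
    (hf : MDifferentiableOn IN IH f U) (h0 : ∀ y ∈ U, mfd IN IH f y = 0) {x : N} (hx : x ∈ U) :
    ∀ᶠ y in 𝓝 x, f y = f x := by
  have hfd : ∀ y ∈ U, MDifferentiableAt IN IH f y := fun y hy ↦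
    (hf y hy).mdifferentiableAt (hU.mem_nhds hy)
  let χ := extChartAt IN x
  let κ := extChartAt IH (f x)
  have hχ := isLocalParam_extChartAt_symm (IN := IN) x
  have hχ0 : χ.symm (χ x) = x := extChartAt_to_inv x
  have hc : ContinuousAt χ.symm (χ x) :=
    (hχ.mdifferentiableAt (mem_extChartAt_target x)).continuousAt
  have n0 : ∀ᶠ y in 𝓝 (χ.symm (χ x)), y ∈ U ∧ f y ∈ κ.source := by
    rw [hχ0]
    exact (hU.eventually_mem hx).and
      ((hfd x hx).continuousAt.eventually_mem (extChartAt_source_mem_nhds (f x)))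
  have n1 : ∀ᶠ z in 𝓝 (χ x), z ∈ χ.target ∧ χ.symm z ∈ U ∧ f (χ.symm z) ∈ κ.source :=
    (hχ.isOpen.eventually_mem (mem_extChartAt_target x)).and (hc.eventually n0)
  obtain ⟨r, hr, hball⟩ := Metric.eventually_nhds_iff_ball.1 n1
  have hF : ∀ z ∈ ball (χ x) r, MDifferentiableAt 𝓘(ℝ, EN) 𝓘(ℝ, EH) (fun z ↦ κ (f (χ.symm z))) z ∧
      mfd 𝓘(ℝ, EN) 𝓘(ℝ, EH) (fun z ↦ κ (f (χ.symm z))) z = 0 := by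
    intro z hz
    obtain ⟨h1, h2, h3⟩ := hball z hz
    have d1 : MDifferentiableAt 𝓘(ℝ, EN) IN χ.symm z := hχ.mdifferentiableAt h1
    have d2 : MDifferentiableAt 𝓘(ℝ, EN) IH (fun z ↦ f (χ.symm z)) z := (hfd _ h2).comp z d1
    have d3 : MDifferentiableAt IH 𝓘(ℝ, EH) κ (f (χ.symm z)) :=
      mdifferentiableAt_extChartAt (by rwa [← extChartAt_source IH])
    refine ⟨d3.comp z d2, ?_⟩
    have e1 := mfd_comp (f := fun z ↦ f (χ.symm z)) d3 d2
    have e2 := mfd_comp (hfd _ h2) d1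
    rw [h0 _ h2, ContinuousLinearMap.zero_comp] at e2
    exact e1.trans ((congrArg _ e2).trans (ContinuousLinearMap.comp_zero _))
  have hconst : ∀ z ∈ ball (χ x) r, κ (f (χ.symm z)) = κ (f x) := by
    intro z hz
    have := isOpen_ball.is_const_of_fderiv_eq_zero (𝕜 := ℝ) (convex_ball (χ x) r).isPreconnected
      (fun z hz ↦ (hF z hz).1.differentiableAt.differentiableWithinAt)
      (fun z hz ↦ (mfd_eq_fderiv).symm.trans (hF z hz).2) hz (mem_ball_self hr)
    rwa [hχ0] at this
  filter_upwards [extChartAt_source_mem_nhds (I := IN) x,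
    (continuousAt_extChartAt (I := IN) x).eventually_mem
      (isOpen_ball.mem_nhds (mem_ball_self hr))] with y hy1 hy2
  have h1 := hconst _ hy2
  have h2 := (hball _ hy2).2.2
  rw [show χ.symm (extChartAt IN x y) = y from χ.left_inv hy1] at h1 h2
  exact κ.injOn h2 (mem_extChartAt_source (f x)) h1

end Const

/-! ### Local flat sections -/

section LocalParam

variable {EN : Type*} [NormedAddCommGroup EN] [NormedSpace ℝ EN]
  {KN : Type*} [TopologicalSpace KN] {IN : ModelWithCorners ℝ EN KN}
  {N : Type*} [TopologicalSpace N] [ChartedSpace KN N]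
  {E : Type*} [NormedAddCommGroup E] [NormedSpace ℝ E]

/-- A smooth map with a differentiable local inverse `θ` is a local parametrisation. -/
theorem IsLocalParam.of_inverse {φ : E → N} {U : Set E} (hU : IsOpen U)
    (hφ : ContMDiffOn 𝓘(ℝ, E) IN ∞ φ U) {θ : N → E}
    (hθ : ∀ z ∈ U, MDifferentiableAt IN 𝓘(ℝ, E) θ (φ z)) (hθφ : ∀ z ∈ U, θ (φ z) = z)
    (hφθ : ∀ z ∈ U, ∀ᶠ p in 𝓝 (φ z), φ (θ p) = p) : IsLocalParam IN φ U := by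
  refine ⟨hU, hφ, fun z hz ↦ ?_⟩
  have hd : ∀ z ∈ U, MDifferentiableAt 𝓘(ℝ, E) IN φ z := fun z hz ↦
    (hφ.contMDiffAt (hU.mem_nhds hz)).mdifferentiableAt (by simp)
  have h1 : (mfd IN 𝓘(ℝ, E) θ (φ z)).comp (mfd 𝓘(ℝ, E) IN φ z) = .id ℝ E := by
    rw [← mfd_comp (hθ z hz) (hd z hz), ← mfd_id (I := 𝓘(ℝ, E)) z]
    exact mfd_congr ((hU.eventually_mem hz).mono hθφ)
  have h2 : (mfd 𝓘(ℝ, E) IN φ z).comp (mfd IN 𝓘(ℝ, E) θ (φ z)) = .id ℝ EN := by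
    have hd' := hd z hz
    rw [← hθφ z hz] at hd'
    have h3 := mfd_comp hd' (hθ z hz)
    rw [hθφ z hz] at h3
    rw [← h3, ← mfd_id (I := IN) (φ z)]
    exact mfd_congr (hφθ z hz)
  exact ContinuousLinearMap.IsInvertible.of_inverse (f := mfd 𝓘(ℝ, E) IN φ z) h2 h1

end LocalParam

section Bundle

variable {EM : Type*} [NormedAddCommGroup EM] [NormedSpace ℝ EM]
  {KM : Type*} [TopologicalSpace KM] {IM : ModelWithCorners ℝ EM KM}
  {M : Type*} [TopologicalSpace M] [ChartedSpace KM M]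
  {EH : Type*} [NormedAddCommGroup EH] [NormedSpace ℝ EH]
  {KH : Type*} [TopologicalSpace KH] {IH : ModelWithCorners ℝ EH KH}
  {H : Type*} [TopologicalSpace H] [ChartedSpace KH H] [Group H]
  {EP : Type*} [NormedAddCommGroup EP] [NormedSpace ℝ EP]
  {KP : Type*} [TopologicalSpace KP] {IP : ModelWithCorners ℝ EP KP}
  {P : Type*} [TopologicalSpace P] [ChartedSpace KP P]
  {π : P → M} {A : LieForm IP P IH H} {s t : M → P} {U V : Set M}

open MulOpposite

/-- A smooth local section `s` of `π` over the open set `U` which is horizontal for `A`, that is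
`s^*A = 0`. -/
structure IsFlatSection (IM : ModelWithCorners ℝ EM KM) (IP : ModelWithCorners ℝ EP KP) (π : P → M)
    (A : LieForm IP P IH H) (s : M → P) (U : Set M) : Prop where
  isOpen : IsOpen U
  smooth : ContMDiffOn IM IP ∞ s U
  proj : ∀ x ∈ U, π (s x) = x
  horizontal : ∀ x ∈ U, ∀ v, A.toFun (s x) (mfd IM IP s x v) = 0

theorem IsFlatSection.mdifferentiableAt (hs : IsFlatSection IM IP π A s U) {x : M} (hx : x ∈ U) :
    MDifferentiableAt IM IP s x :=
  (hs.smooth.contMDiffAt (hs.isOpen.mem_nhds hx)).mdifferentiableAt (by simp)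

theorem lieBr_zero : lieBr IH H 0 0 = 0 :=
  (GroupLieAlgebra.bracket_def (I := IH) (G := H) 0 0).trans
    (congrFun VectorField.mlieBracket_self _)

variable [MulAction Hᵐᵒᵖ P] [LieGroup IH ∞ H] [IM.Boundaryless] [IsManifold IM ∞ M]
  [IH.Boundaryless]

/-- Local coordinates of the bundle: `(x, y) ↦ s(χ⁻¹ x) κ⁻¹(y)`, where `s` is a local section and
`χ`, `κ` are charts of the base and of the group. -/
def bundleParam (s : M → P) (χ : EM → M) (κ : EH → H) (z : EM × EH) : P :=
  op (κ z.2) • s (χ z.1)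

/-- The inverse of `bundleParam` is built from the division map of the local section. -/
theorem isLocalParam_bundleParam (hπ : IsPrincipalBundle IM IH H IP π) {O : Set M}
    (hO : IsOpen O) (hs : ContMDiffOn IM IP ∞ s O) (hsπ : ∀ x ∈ O, π (s x) = x) (x₀ : M) (k₀ : H) :
    IsLocalParam IP
      (bundleParam s (extChartAt IM x₀).symm (extChartAt IH k₀).symm)
      (((extChartAt IM x₀).target ∩ (extChartAt IM x₀).symm ⁻¹' O) ×ˢ
        (extChartAt IH k₀).target) := by
  have hχ := isLocalParam_extChartAt_symm (IN := IM) x₀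
  have hκ := isLocalParam_extChartAt_symm (IN := IH) k₀
  have hU : IsOpen ((extChartAt IM x₀).target ∩ (extChartAt IM x₀).symm ⁻¹' O) :=
    hχ.contMDiffOn.continuousOn.isOpen_inter_preimage hχ.isOpen hO
  obtain ⟨g, hg, hgs⟩ := hπ.exists_division hO hs hsπ
  have hgm : ∀ x ∈ O, ∀ k : H, g (op k • s x) = k := fun x hx k ↦ by
    have h1 : π (op k • s x) = x := by rw [hπ.proj_act, hsπ x hx]
    have h2 := hgs (op k • s x) (by rwa [mem_preimage, h1])
    rw [h1] at h2
    exact hπ.smul_injective h2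
  have hπm : ∀ x ∈ O, ∀ k : H, π (op k • s x) = x := fun x hx k ↦ by rw [hπ.proj_act, hsπ x hx]
  let θ : P → EM × EH := fun p ↦ (extChartAt IM x₀ (π p), extChartAt IH k₀ (g p))
  refine IsLocalParam.of_inverse (hU.prod hκ.isOpen) ?_ (θ := θ) ?_ ?_ ?_
  · refine hπ.contMDiff_act.comp_contMDiffOn (ContMDiffOn.prodMk ?_ ?_)
    · exact hs.comp (hχ.contMDiffOn.comp contDiff_fst.contMDiff.contMDiffOn fun z hz ↦ hz.1.1)
        fun z hz ↦ hz.1.2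
    · exact hκ.contMDiffOn.comp contDiff_snd.contMDiff.contMDiffOn fun z hz ↦ hz.2
  · rintro z ⟨⟨hz1, hz2⟩, hz3⟩
    have e1 : π (bundleParam s (extChartAt IM x₀).symm (extChartAt IH k₀).symm z) =
      (extChartAt IM x₀).symm z.1 := hπm _ hz2 _
    have e2 : g (bundleParam s (extChartAt IM x₀).symm (extChartAt IH k₀).symm z) =
      (extChartAt IH k₀).symm z.2 := hgm _ hz2 _
    refine ContMDiffAt.mdifferentiableAt (n := ∞) (ContMDiffAt.prodMk_space ?_ ?_) (by simp)
    · refine ContMDiffAt.comp _ (contMDiffAt_extChartAt' ?_) hπ.contMDiff_proj.contMDiffAt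
      rw [e1, ← extChartAt_source IM]
      exact (extChartAt IM x₀).map_target hz1
    · refine ContMDiffAt.comp _ (contMDiffAt_extChartAt' ?_) (hg.contMDiffAt ?_)
      · rw [e2, ← extChartAt_source IH]
        exact (extChartAt IH k₀).map_target hz3
      · exact (hO.preimage hπ.contMDiff_proj.continuous).mem_nhds
          (by rw [mem_preimage, e1]; exact hz2)
  · rintro z ⟨⟨hz1, hz2⟩, hz3⟩
    refine Prod.ext ?_ ?_
    · simp only [θ, bundleParam, hπm _ hz2]
      exact (extChartAt IM x₀).right_inv hz1
    · simp only [θ, bundleParam, hgm _ hz2]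
      exact (extChartAt IH k₀).right_inv hz3
  · rintro z ⟨⟨hz1, hz2⟩, hz3⟩
    have e1 : π (bundleParam s (extChartAt IM x₀).symm (extChartAt IH k₀).symm z) =
      (extChartAt IM x₀).symm z.1 := hπm _ hz2 _
    have e2 : g (bundleParam s (extChartAt IM x₀).symm (extChartAt IH k₀).symm z) =
      (extChartAt IH k₀).symm z.2 := hgm _ hz2 _
    have hπc : Continuous π := hπ.contMDiff_proj.continuous
    have hm : bundleParam s (extChartAt IM x₀).symm (extChartAt IH k₀).symm z ∈ π ⁻¹' O := by
      rw [mem_preimage, e1]; exact hz2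
    have hOn := (hO.preimage hπc).mem_nhds hm
    have n1 := hπc.continuousAt.eventually_mem ((isOpen_extChartAt_source (I := IM) x₀).mem_nhds
      (e1 ▸ (extChartAt IM x₀).map_target hz1))
    have n2 := (hg.contMDiffAt hOn).continuousAt.eventually_mem
      ((isOpen_extChartAt_source (I := IH) k₀).mem_nhds (e2 ▸ (extChartAt IH k₀).map_target hz3))
    filter_upwards [n1, n2, hOn] with p h1 h2 h3
    simp only [bundleParam, θ]
    rw [(extChartAt IM x₀).left_inv h1, (extChartAt IH k₀).left_inv h2, hgs p h3]

variable [IsManifold IP ∞ P]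

/-- On the vertical directions of the coordinates `bundleParam`, a connection form is invertible. -/
theorem isInvertible_coord_bundleParam (hπ : IsPrincipalBundle IM IH H IP π)
    (hA : IsConnectionForm IH IP A) {O : Set M}
    (hO : IsOpen O) (hs : ContMDiffOn IM IP ∞ s O) (x₀ : M) (k₀ : H) {z : EM × EH}
    (hz : z ∈ ((extChartAt IM x₀).target ∩ (extChartAt IM x₀).symm ⁻¹' O) ×ˢ
      (extChartAt IH k₀).target) :
    ((A.coord (bundleParam s (extChartAt IM x₀).symm (extChartAt IH k₀).symm) z).comp
      (ContinuousLinearMap.inr ℝ EM EH)).IsInvertible := by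
  have hχ := isLocalParam_extChartAt_symm (IN := IM) x₀
  have hκ := isLocalParam_extChartAt_symm (IN := IH) k₀
  let k := (extChartAt IH k₀).symm z.2
  have h1 : (A.coord (bundleParam s (extChartAt IM x₀).symm (extChartAt IH k₀).symm) z).comp
      (ContinuousLinearMap.inr ℝ EM EH) =
      ((maurerCartan IH : LieForm IH H IH H).toFun k).comp
        (mfd 𝓘(ℝ, EH) IH (extChartAt IH k₀).symm z.2) := by
    ext w
    have d1 : MDifferentiableAt 𝓘(ℝ, EM) IP (fun x ↦ s ((extChartAt IM x₀).symm x)) z.1 :=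
      ((hs.contMDiffAt (hO.mem_nhds hz.1.2)).mdifferentiableAt (by simp)).comp _
        (hχ.mdifferentiableAt hz.1.1)
    have d2 := hκ.mdifferentiableAt hz.2
    have f1 : MDifferentiableAt 𝓘(ℝ, EM × EH) 𝓘(ℝ, EM) (Prod.fst : EM × EH → EM) z :=
      differentiableAt_fst.mdifferentiableAt
    have f2 : MDifferentiableAt 𝓘(ℝ, EM × EH) 𝓘(ℝ, EH) (Prod.snd : EM × EH → EH) z :=
      differentiableAt_snd.mdifferentiableAt
    have h2 := hA.toFun_mfd_smul hπ.contMDiff_act (d1.comp z f1) (d2.comp z f2) ((0, w) : EM × EH)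
    have e1 := mfd_comp_apply d1 f1 ((0, w) : EM × EH)
    have e2 := mfd_comp_apply d2 f2 ((0, w) : EM × EH)
    rw [mfd_eq_fderiv, fderiv_fst] at e1
    rw [mfd_eq_fderiv, fderiv_snd] at e2
    simp only [Function.comp_def] at h2
    rw [e1, e2] at h2
    simp only [ContinuousLinearMap.coe_fst', ContinuousLinearMap.coe_snd', map_zero, zero_add] at h2
    exact h2
  rw [h1]
  refine ContinuousLinearMap.IsInvertible.comp ?_ (hκ.isInvertible _ hz.2)
  exact ContinuousLinearMap.IsInvertible.of_inverse (g := mfd IH IH (fun a : H ↦ k * a) 1)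
    (ContinuousLinearMap.ext fun v ↦ maurerCartan_mfd_mul k v)
    (ContinuousLinearMap.ext fun v ↦ mfd_mul_maurerCartan k v)

variable [FiniteDimensional ℝ EM] [FiniteDimensional ℝ EH] [FiniteDimensional ℝ EP]

/-- Through every point of the bundle there is a local flat section. In the coordinates
`bundleParam` it is the graph of the local integral submanifold of `ker A` given by the Frobenius
theorem. -/
theorem exists_isFlatSection (hπ : IsPrincipalBundle IM IH H IP π)
    (hA : IsConnectionForm IH IP A) (hF : A.IsFlat IP IH) (p : P) :
    ∃ (U : Set M) (s : M → P), IsFlatSection IM IP π A s U ∧ π p ∈ U ∧ s (π p) = p := by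
  have := FiniteDimensional.complete ℝ EP
  have := FiniteDimensional.complete ℝ EH
  obtain ⟨O, s, hO, hx₀, hs, hsπ⟩ := hπ.exists_localSection (π p)
  -- as `p = s(π p) k₀`, its coordinates are those of `(π p, k₀)` in charts `χ` and `κ`
  obtain ⟨k₀, hk₀⟩ := hπ.exists_smul_eq (hsπ _ hx₀)
  let x₀ := π p
  let χ := extChartAt IM x₀
  let κ := extChartAt IH k₀
  let ψ := bundleParam s χ.symm κ.symm
  let Ω := (χ.target ∩ χ.symm ⁻¹' O) ×ˢ κ.target
  have hψ : IsLocalParam IP ψ Ω := isLocalParam_bundleParam hπ hO hs hsπ x₀ k₀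
  have hχ0 : χ.symm (χ x₀) = x₀ := extChartAt_to_inv x₀
  have hκ0 : κ.symm (κ k₀) = k₀ := extChartAt_to_inv k₀
  obtain ⟨r, hr, f, hf0, hfs, hf⟩ := TotalODE.exists_graph_subset_ker (W := A.coord ψ) hψ.isOpen
    (contDiffOn_coord hA.smooth hψ.isOpen hψ.contMDiffOn)
    (fun z hz ↦ isInvertible_coord_bundleParam hπ hA hO hs x₀ k₀ hz)
    (fun z hz ξ η h1 h2 ↦ by
      have := LieForm.IsFlat.coord hA.smooth hF hψ hz ξ η
      rw [h1, h2, lieBr_zero, add_zero] at this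
      exact sub_eq_zero.1 this)
    (x₀ := χ x₀) (y₀ := κ k₀)
    ⟨⟨mem_extChartAt_target x₀, by rw [mem_preimage, hχ0]; exact hx₀⟩, mem_extChartAt_target k₀⟩
  have hcχ : ContMDiffOn IM 𝓘(ℝ, EM) ∞ χ χ.source :=
    contMDiffOn_extChartAt.mono (by rw [extChartAt_source])
  have hU : IsOpen (χ.source ∩ χ ⁻¹' ball (χ x₀) r) :=
    hcχ.continuousOn.isOpen_inter_preimage (isOpen_extChartAt_source x₀) isOpen_ball
  have hgr : ContMDiffOn IM 𝓘(ℝ, EM × EH) ∞ (fun x ↦ (χ x, f (χ x)))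
      (χ.source ∩ χ ⁻¹' ball (χ x₀) r) :=
    ContMDiffOn.prodMk_space (hcχ.mono inter_subset_left)
      (hfs.contMDiffOn.comp (hcχ.mono inter_subset_left) fun x hx ↦ hx.2)
  have hmem : ∀ x ∈ χ.source ∩ χ ⁻¹' ball (χ x₀) r, (χ x, f (χ x)) ∈ Ω := fun x hx ↦ (hf _ hx.2).1
  refine ⟨χ.source ∩ χ ⁻¹' ball (χ x₀) r, fun x ↦ ψ (χ x, f (χ x)),
    ⟨hU, hψ.contMDiffOn.comp hgr hmem, fun x hx ↦ ?_, fun x hx v ↦ ?_⟩,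
    ⟨mem_extChartAt_source x₀, mem_ball_self hr⟩, ?_⟩
  · have h1 := (hmem x hx).1.2
    simp only [ψ, bundleParam]
    rw [hπ.proj_act, hsπ _ h1]
    exact χ.left_inv hx.1
  · have d1 : MDifferentiableAt IM 𝓘(ℝ, EM) χ x :=
      (hcχ.contMDiffAt ((isOpen_extChartAt_source x₀).mem_nhds hx.1)).mdifferentiableAt (by simp)
    have d2 : DifferentiableAt ℝ f (χ x) :=
      (hfs.contDiffAt (isOpen_ball.mem_nhds hx.2)).differentiableAt (by simp)
    have d3 : MDifferentiableAt IM 𝓘(ℝ, EM × EH) (fun x ↦ (χ x, f (χ x))) x :=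
      (hgr.contMDiffAt (hU.mem_nhds hx)).mdifferentiableAt (by simp)
    have d4 : HasFDerivAt (fun y ↦ (y, f y)) ((ContinuousLinearMap.id ℝ EM).prod (fderiv ℝ f (χ x)))
        (χ x) := (hasFDerivAt_id _).prodMk d2.hasFDerivAt
    have h1 := mfd_comp_apply (g := fun y ↦ (y, f y)) d4.differentiableAt.mdifferentiableAt d1 v
    rw [mfd_eq_fderiv, d4.fderiv] at h1
    rw [mfd_comp_apply (g := ψ) (f := fun x ↦ (χ x, f (χ x)))
      (hψ.mdifferentiableAt (hmem x hx)) d3, h1]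
    exact (hf _ hx.2).2 _
  · simp only [ψ, bundleParam]
    rw [hf0]
    exact (congrArg₂ (fun (k : H) (x : M) ↦ op k • s x) hκ0 hχ0).trans hk₀

end Bundle

/-! ### Locally constant families of sections -/

/-- Let `S s U` single out some local sections `s` over `U` of a map `π : E → X` onto a simply
connected space. Suppose that there is one through every point, that two of them which agree at a
point agree near it, and that they are permuted by a set `H` of transformations of `E` which is
simply transitive on the fibres. Then there is a global section which is locally one of
them. -/
theorem exists_section_of_locally {X E H : Type*} [TopologicalSpace X] [SimplyConnectedSpace X]
    [LocallyPathConnectedSpace X] {π : E → X} {a : H → E → E} {S : (X → E) → Set X → Prop}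
    (hS : ∀ s U, S s U → IsOpen U ∧ ∀ x ∈ U, π (s x) = x)
    (hex : ∀ p, ∃ s U, S s U ∧ π p ∈ U ∧ s (π p) = p)
    (huniq : ∀ s t U V x, S s U → S t V → x ∈ U → x ∈ V → s x = t x → ∀ᶠ y in 𝓝 x, s y = t y)
    (ha : ∀ h s U, S s U → S (fun x ↦ a h (s x)) U) (haπ : ∀ h p, π (a h p) = π p)
    (htrans : ∀ p q, π p = π q → ∃ h, a h p = q) (hfree : ∀ p h k, a h p = a k p → h = k)
    (hπ : Function.Surjective π) :
    ∃ σ : X → E, (∀ x, π (σ x) = x) ∧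
      ∀ x, ∃ s U, S s U ∧ x ∈ U ∧ ∀ᶠ y in 𝓝 x, σ y = s y := by
  -- the final topology for the given sections makes `π` a covering map
  let _ : TopologicalSpace E :=
    { IsOpen := fun V ↦ ∀ s U, S s U → IsOpen (U ∩ s ⁻¹' V)
      isOpen_univ := fun s U h ↦ by simpa using (hS s U h).1
      isOpen_inter := fun V W hV hW s U h ↦ by
        rw [preimage_inter, inter_inter_distrib_left]
        exact (hV s U h).inter (hW s U h)
      isOpen_sUnion := fun 𝒱 h𝒱 s U h ↦ by
        rw [preimage_sUnion, inter_iUnion₂]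
        exact isOpen_biUnion fun V hV ↦ h𝒱 V hV s U h }
  have isOpen_iff : ∀ V : Set E, IsOpen V ↔ ∀ s U, S s U → IsOpen (U ∩ s ⁻¹' V) := fun V ↦ Iff.rfl
  let _ : TopologicalSpace H := ⊥
  have : DiscreteTopology H := ⟨rfl⟩
  have isOpen_image : ∀ s U, S s U → IsOpen (s '' U) := by
    refine fun s U h ↦ (isOpen_iff _).2 fun t V ht ↦ isOpen_iff_mem_nhds.2 ?_
    rintro y ⟨hy, x, hx, hxy⟩
    obtain rfl : x = y := by rw [← (hS s U h).2 x hx, hxy, (hS t V ht).2 y hy]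
    filter_upwards [huniq s t U V x h ht hx hy hxy, (hS s U h).1.mem_nhds hx,
      (hS t V ht).1.mem_nhds hy] with z hz hzU hzV
    exact ⟨hzV, z, hzU, hz⟩
  have hπc : Continuous π := ⟨fun O hO ↦ (isOpen_iff _).2 fun s U h ↦ by
    have : U ∩ s ⁻¹' (π ⁻¹' O) = U ∩ O := by
      ext x
      refine and_congr_right fun hx ↦ ?_
      rw [mem_preimage, mem_preimage, (hS s U h).2 x hx]
    rw [this]
    exact (hS s U h).1.inter hO⟩
  have hcov : IsCoveringMap π := by
    refine fun x ↦ IsEvenlyCovered.to_isEvenlyCovered_preimage (I := H) ?_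
    obtain ⟨p, rfl⟩ := hπ x
    obtain ⟨s, U, hs, hpU, -⟩ := hex p
    have hsπ := (hS s U hs).2
    have hg : ∀ q, π q ∈ U → ∃ h, a h (s (π q)) = q := fun q hq ↦ htrans _ _ (hsπ _ hq)
    have : Nonempty H := ⟨(htrans p p rfl).choose⟩
    choose! g hg using hg
    have hga : ∀ x ∈ U, ∀ h, g (a h (s x)) = h := fun x hx h ↦ by
      have h1 : π (a h (s x)) = x := by rw [haπ, hsπ x hx]
      have h2 := hg (a h (s x)) (by rwa [h1])
      rw [h1] at h2
      exact hfree _ _ _ h2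
    refine ⟨inferInstance, U, hpU, (hS s U hs).1, (hS s U hs).1.preimage hπc,
      { toFun := fun e ↦ (⟨π e.1, e.2⟩, g e.1)
        invFun := fun z ↦ ⟨a z.2 (s z.1), by rw [mem_preimage, haπ, hsπ _ z.1.2]; exact z.1.2⟩
        left_inv := fun e ↦ Subtype.ext (hg _ e.2)
        right_inv := fun z ↦ Prod.ext (Subtype.ext (by
          change π (a z.2 (s z.1)) = z.1
          rw [haπ, hsπ _ z.1.2])) (hga _ z.1.2 _)
        continuous_toFun := ?_
        continuous_invFun := ?_ }, fun _ ↦ rfl⟩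
    · refine ((hπc.comp continuous_subtype_val).subtype_mk _).prodMk ?_
      refine continuous_discrete_rng.2 fun h ↦ ?_
      have : (fun e : π ⁻¹' U ↦ g e.1) ⁻¹' {h} = Subtype.val ⁻¹' ((fun x ↦ a h (s x)) '' U) := by
        ext e
        constructor
        · rintro rfl
          exact ⟨π e, e.2, hg _ e.2⟩
        · rintro ⟨x, hx, hxe⟩
          rw [mem_preimage, ← hxe, hga x hx, mem_singleton_iff]
      rw [this]
      exact (isOpen_image _ U (ha h s U hs)).preimage continuous_subtype_val
    · refine Continuous.subtype_mk (continuous_prod_of_discrete_right.2 fun h ↦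
        ⟨fun V hV ↦ ?_⟩) _
      exact isOpen_induced_iff.2 ⟨_, hV _ U (ha h s U hs), by ext x; simp⟩
  obtain ⟨p₀⟩ : Nonempty E := ⟨(hπ (Classical.arbitrary X)).choose⟩
  obtain ⟨σ, ⟨-, hσ⟩, -⟩ := hcov.existsUnique_continuousMap_lifts (.id X) (π p₀) p₀ rfl
  have hσπ : ∀ x, π (σ x) = x := fun x ↦ congrFun hσ x
  refine ⟨σ, hσπ, fun x ↦ ?_⟩
  obtain ⟨s, U, hs, hxU, hsx⟩ := hex (σ x)
  rw [hσπ] at hxU hsx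
  refine ⟨s, U, hs, hxU, ?_⟩
  filter_upwards [σ.continuous.continuousAt.eventually_mem
    ((isOpen_image s U hs).mem_nhds ⟨x, hxU, hsx⟩)] with y ⟨z, hz, hzy⟩
  obtain rfl : z = y := by rw [← (hS s U hs).2 z hz, hzy, hσπ]
  exact hzy.symm

/-! ### Global flat sections -/

section Bundle

variable {EM : Type*} [NormedAddCommGroup EM] [NormedSpace ℝ EM]
  {KM : Type*} [TopologicalSpace KM] {IM : ModelWithCorners ℝ EM KM}
  {M : Type*} [TopologicalSpace M] [ChartedSpace KM M]
  {EH : Type*} [NormedAddCommGroup EH] [NormedSpace ℝ EH]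
  {KH : Type*} [TopologicalSpace KH] {IH : ModelWithCorners ℝ EH KH}
  {H : Type*} [TopologicalSpace H] [ChartedSpace KH H] [Group H] [LieGroup IH ∞ H]
  {EP : Type*} [NormedAddCommGroup EP] [NormedSpace ℝ EP]
  {KP : Type*} [TopologicalSpace KP] {IP : ModelWithCorners ℝ EP KP}
  {P : Type*} [TopologicalSpace P] [ChartedSpace KP P] [IsManifold IP ∞ P] [MulAction Hᵐᵒᵖ P]
  {π : P → M} {A : LieForm IP P IH H} {s t : M → P} {U V : Set M}

open MulOpposite

namespace IsFlatSection

theorem smul (hs : IsFlatSection IM IP π A s U) (hπ : IsPrincipalBundle IM IH H IP π)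
    (hA : IsConnectionForm IH IP A) (h : H) :
    IsFlatSection IM IP π A (fun x ↦ op h • s x) U := by
  refine ⟨hs.isOpen, (contMDiff_smul_right hπ.contMDiff_act h).comp_contMDiffOn hs.smooth,
    fun x hx ↦ by rw [hπ.proj_act, hs.proj x hx], fun x hx v ↦ ?_⟩
  have h1 := hA.toFun_mfd_smul hπ.contMDiff_act (hs.mdifferentiableAt hx)
    (mdifferentiableAt_const (c := h)) v
  rw [hs.horizontal x hx, mfd_const, map_zero, zero_apply, map_zero, add_zero] at h1
  exact h1

/-- Flat sections which agree at a point agree near it. -/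
theorem eventually_eq [IM.Boundaryless] [IsManifold IM ∞ M] (hs : IsFlatSection IM IP π A s U)
    (ht : IsFlatSection IM IP π A t V) (hπ : IsPrincipalBundle IM IH H IP π)
    (hA : IsConnectionForm IH IP A) {x : M} (hxU : x ∈ U) (hxV : x ∈ V) (hx : s x = t x) :
    ∀ᶠ y in 𝓝 x, s y = t y := by
  obtain ⟨g, hg, hgs⟩ := hπ.exists_division hs.isOpen hs.smooth hs.proj
  have hO := hs.isOpen.inter ht.isOpen
  have hgt : ∀ y ∈ U ∩ V, op (g (t y)) • s y = t y := fun y hy ↦ by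
    have := hgs (t y) (by rw [mem_preimage, ht.proj y hy.2]; exact hy.1)
    rwa [ht.proj y hy.2] at this
  have hgd : ContMDiffOn IM IH ∞ (fun y ↦ g (t y)) (U ∩ V) :=
    hg.comp (ht.smooth.mono inter_subset_right) fun y hy ↦ by
      exact (show π (t y) ∈ U by rw [ht.proj y hy.2]; exact hy.1)
  -- by the product rule, the transition map `g ∘ t` from `s` to `t` has vanishing differential
  have hd0 : ∀ y ∈ U ∩ V, mfd IM IH (fun y ↦ g (t y)) y = 0 := by
    refine fun y hy ↦ ContinuousLinearMap.ext fun v ↦ ?_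
    have h1 := hA.toFun_mfd_smul hπ.contMDiff_act (hs.mdifferentiableAt hy.1)
      ((hgd.contMDiffAt (hO.mem_nhds hy)).mdifferentiableAt (by simp)) v
    have h2 : mfd IM IP (fun y ↦ op (g (t y)) • s y) y = mfd IM IP t y :=
      mfd_congr ((hO.eventually_mem hy).mono hgt)
    rw [h2, hgt y hy, ht.horizontal y hy.2, hs.horizontal y hy.1, map_zero, zero_add] at h1
    rw [← mfd_mul_maurerCartan (IH := IH) (g (t y)) (mfd IM IH (fun y ↦ g (t y)) y v), ← h1,
      map_zero, zero_apply]
  have h1 : g (t x) = 1 := hπ.smul_injective (p := s x) (by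
    rw [hgt x ⟨hxU, hxV⟩, op_one, one_smul, hx])
  filter_upwards [eventually_eq_of_mfd_eq_zero hO (hgd.mdifferentiableOn (by simp)) hd0 ⟨hxU, hxV⟩,
    hO.eventually_mem ⟨hxU, hxV⟩] with y hy hyO
  rw [← hgt y hyO, hy, h1, op_one, one_smul]

end IsFlatSection

/-- If a connection form has a global flat section, it is `u du⁻¹` for the dressing field `u` with
`p u(p) = σ(π p)`. -/
theorem IsFlatSection.exists_dressingField (hπ : IsPrincipalBundle IM IH H IP π)
    (hA : IsConnectionForm IH IP A) (hs : IsFlatSection IM IP π A s univ) :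
    ∃ u : P → H, IsDressingField IH IP u ∧ A = pureGauge IP IH u := by
  obtain ⟨g, hg, hgs⟩ := hπ.exists_division hs.isOpen hs.smooth hs.proj
  replace hgs : ∀ p, op (g p) • s (π p) = p := fun p ↦ hgs p (mem_univ _)
  rw [preimage_univ, contMDiffOn_univ] at hg
  refine ⟨fun p ↦ (g p)⁻¹, ⟨hg.inv, fun p h ↦ ?_⟩,
    funext fun p ↦ ContinuousLinearMap.ext fun v ↦ ?_⟩
  · rw [← mul_inv_rev, inv_inj]
    refine hπ.smul_injective (p := s (π p)) ?_
    have := hgs (op h • p)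
    rw [hπ.proj_act] at this
    rw [this, op_mul_smul, hgs]
  · have hπd : MDifferentiableAt IP IM π p := hπ.contMDiff_proj.mdifferentiable (by simp) p
    have hsd : MDifferentiableAt IM IP s (π p) := hs.mdifferentiableAt (mem_univ _)
    have h1 := hA.toFun_mfd_smul hπ.contMDiff_act (f := fun q ↦ s (π q)) (h := g) (x := p)
      (hsd.comp p hπd) (hg.mdifferentiable (by simp) p) v
    rw [show mfd IP IP (fun q ↦ s (π q)) p v = _ from mfd_comp_apply hsd hπd v,
      hs.horizontal _ (mem_univ _), map_zero, zero_add] at h1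
    simp only [hgs] at h1
    rw [mfd_id] at h1
    simp only [pureGauge, inv_inv]
    exact h1

/-- Over a simply connected base, a flat connection has a global flat section. -/
theorem IsConnectionForm.exists_isFlatSection_univ [FiniteDimensional ℝ EM] [IM.Boundaryless]
    [IsManifold IM ∞ M] [SimplyConnectedSpace M] [FiniteDimensional ℝ EH] [IH.Boundaryless]
    [FiniteDimensional ℝ EP]
    (hπ : IsPrincipalBundle IM IH H IP π) (hA : IsConnectionForm IH IP A) (hF : A.IsFlat IP IH) :
    ∃ σ : M → P, IsFlatSection IM IP π A σ univ := by
  have : LocallyPathConnectedSpace KM :=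
    IM.toHomeomorph.isOpenEmbedding.locallyPathConnectedSpace
  have : LocallyPathConnectedSpace M := ChartedSpace.locallyPathConnectedSpace KM M
  obtain ⟨σ, hσπ, hσ⟩ := exists_section_of_locally (π := π) (a := fun (h : H) p ↦ op h • p)
    (S := fun s U ↦ IsFlatSection IM IP π A s U) (fun s U h ↦ ⟨h.isOpen, h.proj⟩)
    (fun p ↦ by
      obtain ⟨U, s, h⟩ := exists_isFlatSection hπ hA hF p
      exact ⟨s, U, h⟩)
    (fun s t U V x hs ht hxU hxV h ↦ hs.eventually_eq ht hπ hA hxU hxV h)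
    (fun h s U hs ↦ hs.smul hπ hA h) (fun h p ↦ hπ.proj_act p h)
    (fun p q h ↦ hπ.exists_smul_eq h) (fun p h k hk ↦ hπ.smul_injective hk)
    (fun x ↦ by
      obtain ⟨U, s, -, hx, -, hs⟩ := hπ.exists_localSection x
      exact ⟨s x, hs x hx⟩)
  refine ⟨σ, isOpen_univ, fun x _ ↦ ?_, fun x _ ↦ hσπ x, fun x _ v ↦ ?_⟩
  · obtain ⟨s, U, hs, hx, h⟩ := hσ x
    have h1 := hs.smooth.contMDiffAt (hs.isOpen.mem_nhds hx)
    exact (h1.congr_of_eventuallyEq h).contMDiffWithinAt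
  · obtain ⟨s, U, hs, hx, h⟩ := hσ x
    rw [mfd_congr h, h.self_of_nhds]
    exact hs.horizontal x hx v

end Bundle

end GaugeTheory

end

end

theorem mainTheorem2
    {EM : Type*} [NormedAddCommGroup EM] [NormedSpace ℝ EM] [FiniteDimensional ℝ EM]
    {KM : Type*} [TopologicalSpace KM] (IM : ModelWithCorners ℝ EM KM) [IM.Boundaryless]
    {M : Type*} [TopologicalSpace M] [ChartedSpace KM M] [IsManifold IM ∞ M]
    [T2Space M] [ParacompactSpace M] [SimplyConnectedSpace M]
    {EH : Type*} [NormedAddCommGroup EH] [NormedSpace ℝ EH] [FiniteDimensional ℝ EH]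
    {KH : Type*} [TopologicalSpace KH] (IH : ModelWithCorners ℝ EH KH) [IH.Boundaryless]
    {H : Type*} [TopologicalSpace H] [ChartedSpace KH H] [Group H] [LieGroup IH ∞ H] [T2Space H]
    {EP : Type*} [NormedAddCommGroup EP] [NormedSpace ℝ EP] [FiniteDimensional ℝ EP]
    {KP : Type*} [TopologicalSpace KP] (IP : ModelWithCorners ℝ EP KP) [IP.Boundaryless]
    {P : Type*} [TopologicalSpace P] [ChartedSpace KP P] [IsManifold IP ∞ P] [T2Space P]
    [MulAction Hᵐᵒᵖ P] (π : P → M) (hπ : IsPrincipalBundle IM IH H IP π) :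
    -- flat connections exist if and only if dressing fields exist
    ((∃ A : LieForm IP P IH H,
        IsConnectionForm IH IP A ∧ A.IsFlat IP IH) ↔
      ∃ u : P → H, IsDressingField IH IP u) ∧
    -- every flat connection is `u du⁻¹` for some dressing field `u`
    (∀ A : LieForm IP P IH H,
      IsConnectionForm IH IP A → A.IsFlat IP IH →
        ∃ u : P → H, IsDressingField IH IP u ∧
          A = pureGauge IP IH u) ∧
    -- consequences of the existence of a dressing field `u`
    (∀ u : P → H, IsDressingField IH IP u →
      -- `p ↦ (π p, u(p)⁻¹)` trivialises `P`, and `u du⁻¹` is the pulled back Maurer-Cartan form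
      (∃ φ : P ≃ₘ^∞⟮IP, IM.prod IH⟯ (M × H), IsTrivialisation IM IH IP π φ ∧
        (∀ p, φ p = (π p, (u p)⁻¹)) ∧
        pureGauge IP IH u =
          LieForm.pullback IP (IM.prod IH) IH φ
            (LieForm.pullback (IM.prod IH) IH IH (Prod.snd : M × H → H)
              (maurerCartan IH))) ∧
      -- `u du⁻¹` is a flat connection
      IsConnectionForm IH IP (pureGauge IP IH u) ∧
      (pureGauge IP IH u).IsFlat IP IH ∧
      -- in any global section it gives the globally defined pure gauge potential
      (∀ σ : M → P, ContMDiff IM IP ∞ σ → (∀ x, π (σ x) = x) →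
        LieForm.pullback IM IP IH σ (pureGauge IP IH u) =
          pureGauge IM IH (u ∘ σ) ∧
        (pureGauge IM IH (u ∘ σ)).IsFlat IM IH) ∧
      -- gauge transformations
      ∀ γ : P → H, IsGaugeElement IH IP γ →
        u ∘ gaugeMap γ = (fun p ↦ (γ p)⁻¹ * u p) ∧
        IsDressingField IH IP (fun p ↦ (γ p)⁻¹ * u p) ∧
        LieForm.pullback IP IP IH (gaugeMap γ)
            (pureGauge IP IH u) =
          pureGauge IP IH (fun p ↦ (γ p)⁻¹ * u p) ∧
        LieForm.pullback IP IP IH (gaugeMap γ)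
            (pureGauge IP IH u) =
          (fun p ↦ (Ad IH (γ p)⁻¹).comp (pureGauge IP IH u p) +
            invMulD IP IH γ p) ∧
        -- the remaining part of any connection transforms homogeneously
        ∀ A : LieForm IP P IH H, IsConnectionForm IH IP A →
          LieForm.pullback IP IP IH (gaugeMap γ)
              (fun p ↦ A p - pureGauge IP IH u p) =
            fun p ↦ (Ad IH (γ p)⁻¹).comp
              (A p - pureGauge IP IH u p)) := by
  have flat : ∀ {A : LieForm IP P IH H}, IsConnectionForm IH IP A → A.IsFlat IP IH →
      ∃ u : P → H, IsDressingField IH IP u ∧ A = pureGauge IP IH u := fun hA hF ↦ by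
    obtain ⟨σ, hσ⟩ := hA.exists_isFlatSection_univ hπ hF
    exact hσ.exists_dressingField hπ hA
  refine ⟨⟨fun ⟨A, hA, hF⟩ ↦ ?_, fun ⟨u, hu⟩ ↦ ?_⟩, fun A ↦ flat, fun u hu ↦ ?_⟩
  · obtain ⟨u, hu, -⟩ := flat hA hF
    exact ⟨u, hu⟩
  · exact ⟨_, hu.isConnectionForm hπ.contMDiff_act, isFlat_invMulD hu.inv_smooth⟩
  have hA := hu.isConnectionForm hπ.contMDiff_act
  refine ⟨hu.exists_trivialisation hπ, hA, isFlat_invMulD hu.inv_smooth, fun σ hσ _ ↦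
    ⟨invMulD_comp hu.inv_smooth hσ, isFlat_invMulD (hu.smooth.comp hσ).inv⟩, fun γ hγ ↦
    ⟨hu.comp_gaugeMap, hu.gauge hγ, ?_, hA.pullback_gaugeMap hπ hγ,
      fun A hA' ↦ pullback_gaugeMap_sub hπ hA' hA hγ⟩⟩
  refine (invMulD_comp hu.inv_smooth (hγ.contMDiff_gaugeMap hπ)).trans ?_
  exact congrArg (pureGauge IP IH) (hu.comp_gaugeMap (γ := γ))
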